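/- Let $(W,S)$, $S=\{s_i : i\in I\}$, be a simply laced Coxeter system, i.e. its Coxeter matrix satisfies $m_{ij}\in\{2,3\}$ for all $i\ne j$ in $I$ (the set $I$ may be finite or infinite). Let $W$ act on the real vector space $V$ with basis $\{\gamma_i : i\in I\}$ by $s_i v = v-2B(v,\gamma_i)\gamma_i$, where $B$ is the bilinear form with $B(\gamma_i,\gamma_j)=-\cos(\pi/m_{ij})$. Let $\Phi=\{w\gamma_i : w\in W,\ i\in I\}$, let $\Phi^+$ and $\Phi^-$ be the sets of roots whose coefficients in this basis are all nonnegative, respectively all nonpositive, and for $w\in W$ put $\Phi(w)=\{\alpha\in\Phi^+ : w\alpha\in\Phi^-\}$. The height of a root is the sum of its coefficients. The root sequence of a reduced expression $i_1\cdots i_n$ is $(r_1,\dots,r_n)$ with $r_q=s_{i_n}\cdots s_{i_{n-q+2}}(\gamma_{i_{n-q+1}})$. A contractible triple of $w$ is a subset of $\Phi(w)$ of the form $\{\alpha,\beta,\alpha+\beta\}$ whose elements appear consecutively, in some order, in the root sequence of some reduced expression for $w$. The element $w$ is *maximally clustered* if any two intersecting contractible triples of $w$ have the same highest root (root of greatest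 height); *freely braided* if it is maximally clustered and its contractible triples are pairwise disjoint; *fully commutative* if any two reduced expressions for $w$ can be transformed into each other by a sequence of moves that replace two adjacent letters $ij$ with $m_{ij}=2$ by $ji$; and *$iji$-avoiding* if no reduced expression for $w$ contains three consecutive letters $iji$ with $m_{ij}=3$. Then the following are equivalent: (i) $W$ has finitely many maximally clustered elements (that is, $W$ is MC-finite); (ii) $W$ has finitely many freely braided elements; (iii) $W$ has finitely many fully commutative elements. Moreover, an element of $W$ is fully commutative if and only if it is $iji$-avoiding. Finally, $W$ is MC-finite if and only if $S$ is finite and every connected component of the Coxeter graph of $(W,S)$ (the graph on $I$ in which distinct $i,j$ are joined exactly when $m_{ij}=3$) is isomorphic to a subgraph of the graph $E_n$ for some $n\ge 6$, where $E_n$ has vertices $0,1,\dots,n-1$, edges $\{k,k+1\}$ for $1\le k\le n-2$, and the edge $\{0,3\}$. -/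

import Mathlib

noncomputable section

set_option linter.unusedSimpArgs false

namespace CoxeterMatrix

variable {B : Type*} (M : CoxeterMatrix B)

/-- A Coxeter matrix is simply laced if all its off-diagonal entries are `2` or `3`. -/
def IsSimplyLaced : Prop := ∀ i j : B, i ≠ j → M i j = 2 ∨ M i j = 3

/-- The Coxeter graph of a simply laced Coxeter matrix: distinct vertices `i`, `j` are joined
exactly when `m_{ij} = 3`. -/
def coxeterGraph : SimpleGraph B where
  Adj i j := i ≠ j ∧ M i j = 3
  symm := ⟨fun i j h => ⟨h.1.symm, by rw [M.symmetric]; exact h.2⟩⟩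
  loopless := ⟨fun _ h => h.1 rfl⟩

/-- The simple root `γ_i`, a basis vector of the real vector space `B →₀ ℝ`. -/
def simpleRoot (_M : CoxeterMatrix B) (i : B) : B →₀ ℝ := Finsupp.single i 1

/-- The Coxeter form, the bilinear form with `B(γ_i, γ_j) = - cos (π / m_{ij})`. -/
def coxeterForm : (B →₀ ℝ) →ₗ[ℝ] (B →₀ ℝ) →ₗ[ℝ] ℝ :=
  Finsupp.linearCombination ℝ fun i =>
    Finsupp.linearCombination ℝ fun j => -Real.cos (Real.pi / (M i j : ℝ))

theorem coxeterForm_simpleRoot (i j : B) :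
    M.coxeterForm (M.simpleRoot i) (M.simpleRoot j) = -Real.cos (Real.pi / (M i j : ℝ)) := by
  simp [coxeterForm, simpleRoot]

/-- The reflection `v ↦ v - 2 B(v, γ_i) γ_i`. -/
def simpleReflection (i : B) : Module.End ℝ (B →₀ ℝ) :=
  LinearMap.id - ((2 : ℝ) • M.coxeterForm.flip (M.simpleRoot i)).smulRight (M.simpleRoot i)

theorem simpleReflection_apply (i : B) (v : B →₀ ℝ) :
    M.simpleReflection i v =
      v - (2 * M.coxeterForm v (M.simpleRoot i)) • M.simpleRoot i := by
  simp [simpleReflection]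

variable {M}

/-- The simple reflections satisfy the defining relations of the Coxeter group. -/
theorem IsSimplyLaced.isLiftable (h : M.IsSimplyLaced) :
    M.IsLiftable M.simpleReflection := by
  intro i j
  have hii : ∀ k, M.coxeterForm (M.simpleRoot k) (M.simpleRoot k) = 1 := fun k => by
    rw [coxeterForm_simpleRoot, M.diagonal]; simp
  have hi := hii i
  have hj := hii j
  have hs : M.coxeterForm (M.simpleRoot j) (M.simpleRoot i) =
      M.coxeterForm (M.simpleRoot i) (M.simpleRoot j) := by
    rw [coxeterForm_simpleRoot, coxeterForm_simpleRoot, M.symmetric]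
  by_cases hij : i = j
  · subst hij
    rw [M.diagonal, pow_one]
    refine LinearMap.ext fun v => ?_
    simp only [Module.End.mul_apply, Module.End.one_apply, simpleReflection_apply, map_sub,
      map_smul, hi]
    module
  · have hc := M.coxeterForm_simpleRoot i j
    rcases h i j hij with h2 | h3
    · rw [h2] at hc
      have hc' : M.coxeterForm (M.simpleRoot i) (M.simpleRoot j) = 0 := by
        rw [hc]; simp
      rw [hc'] at hs
      rw [h2, pow_two]
      refine LinearMap.ext fun v => ?_
      simp only [Module.End.mul_apply, Module.End.one_apply, simpleReflection_apply, map_sub,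
        map_smul, LinearMap.sub_apply, LinearMap.smul_apply, hi, hj, hs, hc', smul_eq_mul]
      module
    · rw [h3] at hc
      have hc' : M.coxeterForm (M.simpleRoot i) (M.simpleRoot j) = -(1 / 2) := by
        rw [hc]; simp [Real.cos_pi_div_three]
      rw [hc'] at hs
      rw [h3, pow_succ, pow_two]
      refine LinearMap.ext fun v => ?_
      simp only [Module.End.mul_apply, Module.End.one_apply, simpleReflection_apply, map_sub,
        map_smul, LinearMap.sub_apply, LinearMap.smul_apply, hi, hj, hs, hc', smul_eq_mul]
      module

end CoxeterMatrix

namespace CoxeterSystem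

variable {B W : Type*} [Group W] {M : CoxeterMatrix B} (cs : CoxeterSystem M W)

/-- The reflection representation of a simply laced Coxeter group on `B →₀ ℝ`. -/
def reflectionRep (h : M.IsSimplyLaced) : W →* Module.End ℝ (B →₀ ℝ) :=
  cs.lift ⟨M.simpleReflection, h.isLiftable⟩

variable (h : M.IsSimplyLaced)

/-- The root system `Φ = {w γ_i}`. -/
def roots : Set (B →₀ ℝ) := {v | ∃ (w : W) (i : B), v = cs.reflectionRep h w (M.simpleRoot i)}

/-- The positive roots `Φ⁺`. -/
def posRoots : Set (B →₀ ℝ) := {v | v ∈ cs.roots h ∧ ∀ i, 0 ≤ v i}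

/-- The negative roots `Φ⁻`. -/
def negRoots : Set (B →₀ ℝ) := {v | v ∈ cs.roots h ∧ ∀ i, v i ≤ 0}

/-- The set `Φ(w)` of positive roots sent to negative roots by `w`. -/
def inversionSet (w : W) : Set (B →₀ ℝ) :=
  {v | v ∈ cs.posRoots h ∧ cs.reflectionRep h w v ∈ cs.negRoots h}

/-- The height of a vector: the sum of its coefficients with respect to the simple roots. -/
def height (v : B →₀ ℝ) : ℝ := v.sum fun _ c => c

/-- The root sequence `(r_1, …, r_n)` of a word `i_1 ⋯ i_n`, where
`r_q = s_{i_n} ⋯ s_{i_{n-q+2}} (γ_{i_{n-q+1}})`. The last term is `(s_{i_2} ⋯ s_{i_n})⁻¹ γ_{i_1}`,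
and the earlier terms are the root sequence of `i_2 ⋯ i_n`. -/
def rootSeq : List B → List (B →₀ ℝ)
  | [] => []
  | i :: ω => rootSeq ω ++ [cs.reflectionRep h (cs.wordProd ω)⁻¹ (M.simpleRoot i)]

/-- `ω` is a reduced expression for `w`. -/
def IsReducedExpr (ω : List B) (w : W) : Prop := cs.IsReduced ω ∧ cs.wordProd ω = w

/-- An inversion triple of `w`: a subset of `Φ(w)` of the form `{α, β, α + β}`. -/
def IsInversionTriple (w : W) (T : Set (B →₀ ℝ)) : Prop :=
  T ⊆ cs.inversionSet h w ∧ ∃ α β : B →₀ ℝ, T = {α, β, α + β}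

/-- A contractible triple of `w`: an inversion triple whose elements are consecutive, in some
order, in some root sequence for `w`. -/
def IsContractibleTriple (w : W) (T : Set (B →₀ ℝ)) : Prop :=
  cs.IsInversionTriple h w T ∧
    ∃ ω : List B, cs.IsReducedExpr ω w ∧
      ∃ (l₁ l₂ : List (B →₀ ℝ)) (a b c : B →₀ ℝ),
        cs.rootSeq h ω = l₁ ++ [a, b, c] ++ l₂ ∧ T = {a, b, c}

/-- `γ` is a root of maximal height in `T`. -/
def IsHighestRoot (T : Set (B →₀ ℝ)) (γ : B →₀ ℝ) : Prop :=
  γ ∈ T ∧ ∀ δ ∈ T, height δ ≤ height γ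

/-- `w` is maximally clustered: intersecting contractible triples of `w` have the same
highest root. -/
def IsMaximallyClustered (w : W) : Prop :=
  ∀ T T' : Set (B →₀ ℝ), cs.IsContractibleTriple h w T → cs.IsContractibleTriple h w T' →
    (T ∩ T').Nonempty →
      ∀ γ γ' : B →₀ ℝ, IsHighestRoot T γ → IsHighestRoot T' γ' → γ = γ'

/-- `w` is freely braided: it is maximally clustered and its contractible triples are
pairwise disjoint. -/
def IsFreelyBraided (w : W) : Prop :=
  cs.IsMaximallyClustered h w ∧
    ∀ T T' : Set (B →₀ ℝ), cs.IsContractibleTriple h w T → cs.IsContractibleTriple h w T' →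
      T ≠ T' → Disjoint T T'

/-- A short braid move: replace adjacent letters `i j` with `m_{ij} = 2` by `j i`. -/
def ShortBraidMove (M : CoxeterMatrix B) (ω ω' : List B) : Prop :=
  ∃ (u v : List B) (i j : B), M i j = 2 ∧ ω = u ++ [i, j] ++ v ∧ ω' = u ++ [j, i] ++ v

/-- Two words are short braid equivalent if one is obtained from the other by a finite sequence
of short braid moves. -/
def ShortBraidEquiv (M : CoxeterMatrix B) (ω ω' : List B) : Prop :=
  Relation.ReflTransGen (ShortBraidMove M) ω ω'

/-- `w` is fully commutative: all its reduced expressions are short braid equivalent. -/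
def IsFullyCommutative (w : W) : Prop :=
  ∀ ω ω' : List B, cs.IsReducedExpr ω w → cs.IsReducedExpr ω' w → ShortBraidEquiv M ω ω'

/-- `w` is `iji`-avoiding: no reduced expression for `w` has a factor `i j i` of consecutive
letters with `m_{ij} = 3`. -/
def IsIjiAvoiding (w : W) : Prop :=
  ∀ ω : List B, cs.IsReducedExpr ω w →
    ¬ ∃ (u v : List B) (i j : B), M i j = 3 ∧ ω = u ++ [i, j, i] ++ v

end CoxeterSystem

/-- The Coxeter graph of type `E_n` (meant for `n ≥ 6`): vertices `0, 1, …, n - 1`, with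
`1 - 2 - 3 - ⋯ - (n - 1)` a path and `0` joined to `3`. -/
def coxeterGraphE (n : ℕ) : SimpleGraph (Fin n) :=
  SimpleGraph.fromRel fun i j : Fin n =>
    (1 ≤ (i : ℕ) ∧ (i : ℕ) + 1 = (j : ℕ)) ∨ ((i : ℕ) = 0 ∧ (j : ℕ) = 3)

end

/-! A contractible triple always comes from a factor `iji` of a reduced expression. An
`iji`-avoiding element therefore has no contractible triples, so fully commutative elements are
freely braided, and freely braided elements are maximally clustered by definition. It remains to
show that finitely many fully commutative elements force the graph condition, and that the graph
condition leaves only finitely many maximally clustered elements.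

For the first, call a word stable if no sequence of commutations creates a factor `ii` or `iji`.
Stable words are reduced and represent fully commutative elements (`IsStable.isReduced_and_equiv`);
this rests on the sign criterion for descents. A word in which at least two neighbours of a letter
occur between consecutive occurrences of that letter is stable, which is phrased as a firing game.
The game can be played forever on a cycle, on a forked path (affine D), and on the affine E6 and E7
graphs. A finite connected graph containing none of these is a path, or a path with one pendant
vertex near an end, hence lies in some `E_n` (`exists_isContained_coxeterGraphE`). Affine E8 needs
no exclusion, since it is itself an `E_n`.

For the second, call the gap between consecutive occurrences of `i` short if it contains exactly one
neighbour of `i`. In a maximally clustered element two adjacent short gaps of one letter are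
impossible (`not_two_short_gaps`): they give two triples sharing the root of the middle `i` but
having different highest roots. Among equivalent words choose one whose letters lie as far as
possible from the branch vertex 3 of `E_n`. Then every gap of another vertex contains its neighbour
towards 3, so multiplicities grow by at most one per step away from 3. Inner gaps of 3 contain the
vertex 4 (`exists_label_four`), and from this, working outwards along the long arm, the last vertex
of the arm occurs a bounded number of times (`labCount_last_le`). Induction on the length of the arm
bounds the length of the word. -/

namespace CoxeterSystem

variable {B W : Type*} [Group W] {M : CoxeterMatrix B} (cs : CoxeterSystem M W)

/-! ### Simple roots, descents and signs of roots -/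

/-- Generators joined by no edge commute. -/
theorem simple_comm_of_eq_two {i j : B} (hij : M i j = 2) :
    cs.simple i * cs.simple j = cs.simple j * cs.simple i := by
  have h1 := cs.simple_mul_simple_pow i j
  rw [hij, pow_two] at h1
  have h2 := eq_inv_of_mul_eq_one_left h1
  simpa using h2

/-- The braid relation for generators joined by an edge. -/
theorem simple_braid_of_eq_three {i j : B} (hij : M i j = 3) :
    cs.simple i * cs.simple j * cs.simple i = cs.simple j * cs.simple i * cs.simple j := by
  have h1 := cs.simple_mul_simple_pow i j
  rw [hij, pow_succ, pow_two] at h1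
  have h2 : (cs.simple i * cs.simple j * cs.simple i) *
      (cs.simple j * cs.simple i * cs.simple j) = 1 := by
    simpa only [mul_assoc] using h1
  simpa [mul_assoc] using eq_inv_of_mul_eq_one_left h2

variable (h : M.IsSimplyLaced)

theorem reflectionRep_simple (i : B) :
    cs.reflectionRep h (cs.simple i) = M.simpleReflection i :=
  cs.lift_apply_simple h.isLiftable i

theorem reflectionRep_mul_apply (w w' : W) (v : B →₀ ℝ) :
    cs.reflectionRep h (w * w') v = cs.reflectionRep h w (cs.reflectionRep h w' v) := by
  rw [map_mul, Module.End.mul_apply]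

theorem reflectionRep_inv_apply_self (w : W) (v : B →₀ ℝ) :
    cs.reflectionRep h w⁻¹ (cs.reflectionRep h w v) = v := by
  rw [← reflectionRep_mul_apply, inv_mul_cancel, map_one, Module.End.one_apply]

theorem reflectionRep_self_apply_inv (w : W) (v : B →₀ ℝ) :
    cs.reflectionRep h w (cs.reflectionRep h w⁻¹ v) = v := by
  rw [← reflectionRep_mul_apply, mul_inv_cancel, map_one, Module.End.one_apply]

theorem reflectionRep_injective (w : W) : Function.Injective (cs.reflectionRep h w) :=
  Function.LeftInverse.injective (cs.reflectionRep_inv_apply_self h w)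

theorem simple_apply_self (i : B) :
    cs.reflectionRep h (cs.simple i) (M.simpleRoot i) = -M.simpleRoot i := by
  rw [reflectionRep_simple, CoxeterMatrix.simpleReflection_apply,
    CoxeterMatrix.coxeterForm_simpleRoot, M.diagonal]
  simp only [Nat.cast_one, div_one, Real.cos_pi]
  module

theorem simple_apply_of_eq_two {i j : B} (hij : M i j = 2) :
    cs.reflectionRep h (cs.simple i) (M.simpleRoot j) = M.simpleRoot j := by
  rw [reflectionRep_simple, CoxeterMatrix.simpleReflection_apply,
    CoxeterMatrix.coxeterForm_simpleRoot, M.symmetric, hij]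
  simp

theorem simple_apply_of_eq_three {i j : B} (hij : M i j = 3) :
    cs.reflectionRep h (cs.simple i) (M.simpleRoot j) = M.simpleRoot j + M.simpleRoot i := by
  rw [reflectionRep_simple, CoxeterMatrix.simpleReflection_apply,
    CoxeterMatrix.coxeterForm_simpleRoot, M.symmetric, hij]
  norm_num [Real.cos_pi_div_three]

theorem ne_of_eq_three {M : CoxeterMatrix B} {i j : B} (hij : M i j = 3) : i ≠ j := by
  rintro rfl
  rw [M.diagonal] at hij
  omega

/-- If `i` is not a right descent of `w`, then `w` sends the simple root `γ_i` to a vector with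
nonnegative coefficients. -/
theorem nonneg_of_not_isRightDescent {w : W} {i : B} (hi : ¬cs.IsRightDescent w i) (k : B) :
    0 ≤ cs.reflectionRep h w (M.simpleRoot i) k := by
  induction hn : cs.length w using Nat.strong_induction_on generalizing w i with
  | _ n ih =>
  subst hn
  classical
  by_cases hw : w = 1
  · subst hw
    rw [map_one, Module.End.one_apply, CoxeterMatrix.simpleRoot, Finsupp.single_apply]
    split_ifs <;> norm_num
  -- Write w = v s_j with v shorter. If s_i and s_j commute, then wγ_i = vγ_i. Otherwise wγ_i = vγ_i
  -- + vγ_j, and both terms are nonnegative unless i is a descent of v; in that case w = v' s_i s_j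
  -- and s_i s_j γ_i = γ_j, so wγ_i = v'γ_j.
  obtain ⟨j, hj⟩ := cs.exists_rightDescent_of_ne_one hw
  have hij : i ≠ j := by rintro rfl; exact hi hj
  obtain ⟨v, hv⟩ : ∃ v, v = w * cs.simple j := ⟨_, rfl⟩
  have hwv : w = v * cs.simple j := by simp [hv]
  have hlv : cs.length v + 1 = cs.length w := hv ▸ cs.isRightDescent_iff.1 hj
  rw [not_isRightDescent_iff] at hi
  have hvj : ¬cs.IsRightDescent v j := by
    rw [not_isRightDescent_iff, ← hwv]; exact hlv.symm
  rcases h j i hij.symm with hm | hm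
  · have hvi : ¬cs.IsRightDescent v i := by
      intro hd
      rw [isRightDescent_iff] at hd
      have h1 : w * cs.simple i = v * cs.simple i * cs.simple j := by
        rw [hwv, mul_assoc, cs.simple_comm_of_eq_two hm, mul_assoc]
      have h2 := cs.length_mul_le (v * cs.simple i) (cs.simple j)
      rw [← h1, length_simple] at h2
      omega
    have := ih _ (by omega) hvi rfl
    rw [hwv, reflectionRep_mul_apply, simple_apply_of_eq_two _ _ hm]
    exact this
  · by_cases hvi : cs.IsRightDescent v i
    · obtain ⟨v', hv'⟩ : ∃ v', v' = v * cs.simple i := ⟨_, rfl⟩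
      have hvv' : v = v' * cs.simple i := by simp [hv']
      have hlv' : cs.length v' + 1 = cs.length v := hv' ▸ cs.isRightDescent_iff.1 hvi
      have hv'j : ¬cs.IsRightDescent v' j := by
        intro hd
        rw [isRightDescent_iff] at hd
        have h1 : w * cs.simple i = v' * cs.simple j * (cs.simple i * cs.simple j) := by
          rw [hwv, hvv', mul_assoc, mul_assoc, ← mul_assoc (cs.simple i),
            ← cs.simple_braid_of_eq_three hm]
          simp [mul_assoc]
        have h2 := cs.length_mul_le (v' * cs.simple j) (cs.simple i * cs.simple j)
        have h3 := cs.length_mul_le (cs.simple i) (cs.simple j)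
        rw [← h1] at h2
        rw [length_simple, length_simple] at h3
        omega
      have := ih _ (by omega) hv'j rfl
      rw [hwv, hvv', reflectionRep_mul_apply, simple_apply_of_eq_three _ _ hm,
        reflectionRep_mul_apply, map_add, simple_apply_self,
        simple_apply_of_eq_three _ _ (M.symmetric i j ▸ hm)]
      simpa using this
    · have h1 := ih _ (by omega) hvi rfl
      have h2 := ih _ (by omega) hvj rfl
      rw [hwv, reflectionRep_mul_apply, simple_apply_of_eq_three _ _ hm, map_add,
        Finsupp.add_apply]
      exact add_nonneg h1 h2

theorem nonpos_of_isRightDescent {w : W} {i : B} (hi : cs.IsRightDescent w i) (k : B) :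
    cs.reflectionRep h w (M.simpleRoot i) k ≤ 0 := by
  have h1 := cs.nonneg_of_not_isRightDescent h
    (cs.isRightDescent_iff_not_isRightDescent_mul.1 hi) k
  rw [reflectionRep_mul_apply, simple_apply_self, map_neg, Finsupp.neg_apply] at h1
  linarith

theorem root_ne_zero (w : W) (i : B) : cs.reflectionRep h w (M.simpleRoot i) ≠ 0 := by
  intro h0
  have h1 : M.simpleRoot i = 0 := cs.reflectionRep_injective h w (by rw [h0, map_zero])
  simp [CoxeterMatrix.simpleRoot] at h1

/-- A generator is a right descent of `w` if and only if `w` sends the corresponding simple root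
to a negative root. -/
theorem isRightDescent_iff_nonpos {w : W} {i : B} :
    cs.IsRightDescent w i ↔ ∀ k, cs.reflectionRep h w (M.simpleRoot i) k ≤ 0 := by
  refine ⟨fun hi => cs.nonpos_of_isRightDescent h hi, fun hk => ?_⟩
  by_contra hi
  apply cs.root_ne_zero h w i
  ext k
  exact le_antisymm (hk k) (cs.nonneg_of_not_isRightDescent h hi k)

theorem isLeftDescent_iff_nonpos {w : W} {i : B} :
    cs.IsLeftDescent w i ↔ ∀ k, cs.reflectionRep h w⁻¹ (M.simpleRoot i) k ≤ 0 := by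
  rw [← isRightDescent_inv_iff, cs.isRightDescent_iff_nonpos h]

theorem isLeftDescent_mul_of_eq_two (h : M.IsSimplyLaced) {w : W} {i j : B} (hij : M i j = 2)
    (hj : cs.IsLeftDescent w j) : cs.IsLeftDescent (cs.simple i * w) j := by
  rw [cs.isLeftDescent_iff_nonpos h] at hj ⊢
  intro k
  rw [mul_inv_rev, inv_simple, reflectionRep_mul_apply, simple_apply_of_eq_two _ _ hij]
  exact hj k

/-- Here (s_i w)⁻¹γ_j = w⁻¹γ_i + w⁻¹γ_j is a sum of two negative roots, and (s_j s_i w)⁻¹γ_i =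
w⁻¹γ_j. Consequently w has a reduced word that starts with `iji`. -/
theorem isLeftDescent_mul_of_eq_three (h : M.IsSimplyLaced) {w : W} {i j : B} (hij : M i j = 3)
    (hi : cs.IsLeftDescent w i) (hj : cs.IsLeftDescent w j) :
    cs.IsLeftDescent (cs.simple i * w) j ∧
      cs.IsLeftDescent (cs.simple j * (cs.simple i * w)) i := by
  rw [cs.isLeftDescent_iff_nonpos h] at hi hj
  constructor
  · rw [cs.isLeftDescent_iff_nonpos h]
    intro k
    rw [mul_inv_rev, inv_simple, reflectionRep_mul_apply, simple_apply_of_eq_three _ _ hij,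
      map_add, Finsupp.add_apply]
    linarith [hi k, hj k]
  · rw [cs.isLeftDescent_iff_nonpos h]
    intro k
    rw [mul_inv_rev, mul_inv_rev, inv_simple, inv_simple, reflectionRep_mul_apply,
      reflectionRep_mul_apply, simple_apply_of_eq_three _ _ (M.symmetric i j ▸ hij),
      map_add, simple_apply_self, simple_apply_of_eq_three _ _ hij]
    simpa using hj k

end CoxeterSystem

namespace CoxeterSystem

variable {B W : Type*} [Group W] {M : CoxeterMatrix B}

/-! ### Short braid equivalence and stable words -/

theorem ShortBraidMove.symm {ω ω' : List B} (hm : ShortBraidMove M ω ω') :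
    ShortBraidMove M ω' ω := by
  obtain ⟨u, v, i, j, hij, rfl, rfl⟩ := hm
  exact ⟨u, v, j, i, M.symmetric i j ▸ hij, rfl, rfl⟩

theorem ShortBraidMove.perm {ω ω' : List B} (hm : ShortBraidMove M ω ω') : ω.Perm ω' := by
  obtain ⟨u, v, i, j, -, rfl, rfl⟩ := hm
  exact ((List.Perm.swap j i []).append_left u).append_right v

theorem ShortBraidEquiv.symm {ω ω' : List B} (hm : ShortBraidEquiv M ω ω') :
    ShortBraidEquiv M ω' ω := by
  induction hm with
  | refl => exact .refl
  | tail _ h1 ih => exact .head h1.symm ih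

theorem ShortBraidEquiv.trans {ω ω' ω'' : List B} (h₁ : ShortBraidEquiv M ω ω')
    (h₂ : ShortBraidEquiv M ω' ω'') : ShortBraidEquiv M ω ω'' :=
  Relation.ReflTransGen.trans h₁ h₂

theorem ShortBraidEquiv.perm {ω ω' : List B} (hm : ShortBraidEquiv M ω ω') : ω.Perm ω' := by
  induction hm with
  | refl => exact .refl _
  | tail _ h1 ih => exact ih.trans h1.perm

theorem ShortBraidEquiv.cons {ω ω' : List B} (i : B) (hm : ShortBraidEquiv M ω ω') :
    ShortBraidEquiv M (i :: ω) (i :: ω') := by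
  induction hm with
  | refl => exact .refl
  | tail _ h1 ih =>
    obtain ⟨u, v, j, k, hjk, rfl, rfl⟩ := h1
    exact .tail ih ⟨i :: u, v, j, k, hjk, rfl, rfl⟩

theorem ShortBraidEquiv.swap {i j : B} (hij : M i j = 2) (ω : List B) :
    ShortBraidEquiv M (i :: j :: ω) (j :: i :: ω) :=
  .single ⟨[], ω, i, j, hij, rfl, rfl⟩

theorem ShortBraidEquiv.wordProd_eq (cs : CoxeterSystem M W) {ω ω' : List B}
    (hm : ShortBraidEquiv M ω ω') : cs.wordProd ω = cs.wordProd ω' := by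
  induction hm with
  | refl => rfl
  | tail _ h1 ih =>
    obtain ⟨u, v, j, k, hjk, rfl, rfl⟩ := h1
    rw [ih]
    simp only [wordProd_append, wordProd_cons, wordProd_nil, mul_one,
      cs.simple_comm_of_eq_two hjk]

/-- A word is stable if no word short braid equivalent to it has a factor `i i`, or a factor
`i j i` with `m_{ij} = 3`. -/
def IsStable (M : CoxeterMatrix B) (ω : List B) : Prop :=
  ∀ ω', ShortBraidEquiv M ω ω' →
    (∀ u v i, ω' ≠ u ++ [i, i] ++ v) ∧ ∀ u v i j, M i j = 3 → ω' ≠ u ++ [i, j, i] ++ v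

theorem IsStable.of_equiv {ω ω' : List B} (hs : IsStable M ω) (hm : ShortBraidEquiv M ω ω') :
    IsStable M ω' := fun _ h1 => hs _ (hm.trans h1)

theorem IsStable.tail {i : B} {ω : List B} (hs : IsStable M (i :: ω)) : IsStable M ω := by
  intro ω' hm
  obtain ⟨h1, h2⟩ := hs _ (hm.cons i)
  exact ⟨fun u v j hj => h1 (i :: u) v j (by simp [hj]),
    fun u v j k hjk hj => h2 (i :: u) v j k hjk (by simp [hj])⟩

variable (cs : CoxeterSystem M W)

theorem isReduced_cons_iff {i : B} {ω : List B} (hω : cs.IsReduced ω) :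
    cs.IsReduced (i :: ω) ↔ ¬cs.IsLeftDescent (cs.wordProd ω) i := by
  rw [not_isLeftDescent_iff, IsReduced, wordProd_cons, hω.eq, List.length_cons]

theorem IsReduced.of_append_left {cs : CoxeterSystem M W} {u v : List B}
    (hω : cs.IsReduced (u ++ v)) : cs.IsReduced u := by
  simpa using hω.take u.length

theorem IsReduced.of_append_right {cs : CoxeterSystem M W} {u v : List B}
    (hω : cs.IsReduced (u ++ v)) : cs.IsReduced v := by
  simpa using hω.drop u.length

/-- A left descent of `w` is the first letter of a reduced word for `w`. -/
theorem exists_isReduced_cons {w : W} {i : B} (hi : cs.IsLeftDescent w i) :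
    ∃ ω, cs.IsReduced (i :: ω) ∧ cs.wordProd (i :: ω) = w := by
  obtain ⟨ω, hω, hw⟩ := cs.exists_isReduced (cs.simple i * w)
  have h1 : cs.wordProd (i :: ω) = w := by simp [wordProd_cons, ← hw]
  refine ⟨ω, ?_, h1⟩
  rw [isLeftDescent_iff] at hi
  rw [IsReduced, h1, List.length_cons, ← hω.eq, ← hw, hi]

theorem isLeftDescent_of_isReduced {i : B} {ω : List B} (hω : cs.IsReduced (i :: ω)) :
    cs.IsLeftDescent (cs.wordProd (i :: ω)) i := by
  have h1 : cs.IsReduced ω := IsReduced.of_append_right (u := [i]) hω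
  rw [isLeftDescent_iff, hω.eq, wordProd_cons, simple_mul_simple_cancel_left, h1.eq,
    List.length_cons]

/-- Stable words are reduced, and are short braid equivalent to all reduced words for the same
element. -/
theorem IsStable.isReduced_and_equiv (h : M.IsSimplyLaced) {ω : List B} (hs : IsStable M ω) :
    cs.IsReduced ω ∧
      ∀ ω', cs.IsReduced ω' → cs.wordProd ω' = cs.wordProd ω → ShortBraidEquiv M ω ω' := by
  induction hn : ω.length using Nat.strong_induction_on generalizing ω with
  | _ n ih =>
  subst hn
  rcases ω with - | ⟨i, ω⟩
  · refine ⟨by simp [IsReduced], fun ω' hω' hp => ?_⟩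
    have : ω'.length = 0 := by rw [← hω'.eq, hp]; simp
    rw [List.length_eq_zero_iff.1 this]
    exact .refl
  obtain ⟨hr, he⟩ := ih _ (by simp) hs.tail rfl
  have hred : cs.IsReduced (i :: ω) := by
    -- If i were a left descent of the product of ω, then by induction ω would be equivalent to some
    -- iτ, and iω to iiτ.
    rw [cs.isReduced_cons_iff hr]
    intro hd
    obtain ⟨τ, hτ, hτp⟩ := cs.exists_isReduced_cons hd
    exact (hs _ ((he _ hτ hτp).cons i)).1 [] τ i rfl
  refine ⟨hred, fun ω' hω' hp => ?_⟩
  rcases ω' with - | ⟨j, ω'⟩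
  · have := hω'.eq
    rw [hp, hred.eq] at this
    simp at this
  have hr' : cs.IsReduced ω' := IsReduced.of_append_right (u := [j]) hω'
  have hi := cs.isLeftDescent_of_isReduced hred
  have hj := cs.isLeftDescent_of_isReduced hω'
  rw [hp] at hj
  have hlen : ω'.length = ω.length := by
    have := hω'.eq
    rw [hp, hred.eq] at this
    simpa using this.symm
  by_cases hij : i = j
  · subst hij
    refine (he _ hr' ?_).cons i
    simpa [wordProd_cons] using hp
  have hpi : cs.simple i * cs.wordProd (i :: ω) = cs.wordProd ω := by simp [wordProd_cons]
  rcases h i j hij with hm | hm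
  -- Here ω is equivalent to some jτ, hence iω to jiτ; the shorter stable word iτ is then compared
  -- with ω'.
  · have hd := cs.isLeftDescent_mul_of_eq_two h hm hj
    rw [hpi] at hd
    obtain ⟨τ, hτ, hτp⟩ := cs.exists_isReduced_cons hd
    have e1 : ShortBraidEquiv M (i :: ω) (j :: i :: τ) :=
      ((he _ hτ hτp).cons i).trans (.swap hm τ)
    have hs1 : IsStable M (i :: τ) := (hs.of_equiv e1).tail
    have hl : (i :: τ).length = ω.length := by
      rw [← hr.eq, ← hτp, hτ.eq]; simp
    refine e1.trans (((ih _ (by simp at hl ⊢; omega) hs1 rfl).2 ω' hr' ?_).cons j)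
    have e2 := e1.wordProd_eq cs
    rw [← hp, wordProd_cons, wordProd_cons _ j] at e2
    exact mul_left_cancel e2
  -- Here ω would be equivalent to some jiτ, so iω to ijiτ, against stability.
  · obtain ⟨hd1, hd2⟩ := cs.isLeftDescent_mul_of_eq_three h hm hi hj
    rw [hpi] at hd1 hd2
    obtain ⟨τ, hτ, hτp⟩ := cs.exists_isReduced_cons hd2
    have hp2 : cs.wordProd (j :: i :: τ) = cs.wordProd ω := by
      rw [wordProd_cons, hτp, simple_mul_simple_cancel_left]
    have hr2 : cs.IsReduced (j :: i :: τ) := by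
      have := (cs.isLeftDescent_iff).1 hd1
      rw [← hτp, hτ.eq] at this
      rw [IsReduced, hp2, ← this]; rfl
    exact absurd rfl ((hs _ ((he _ hr2 hp2).cons i)).2 [] τ i j hm)

theorem IsStable.isFullyCommutative (h : M.IsSimplyLaced) {ω : List B} (hs : IsStable M ω) :
    cs.IsFullyCommutative (cs.wordProd ω) := by
  intro ω₁ ω₂ h₁ h₂
  have he := (hs.isReduced_and_equiv cs h).2
  exact (he _ h₁.1 h₁.2).symm.trans (he _ h₂.1 h₂.2)

theorem wordProd_braid {u v : List B} {i j : B} (hij : M i j = 3) :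
    cs.wordProd (u ++ [i, j, i] ++ v) = cs.wordProd (u ++ [j, i, j] ++ v) := by
  have key : cs.wordProd [i, j, i] = cs.wordProd [j, i, j] := by
    simpa [wordProd_cons, mul_assoc] using cs.simple_braid_of_eq_three hij
  simp only [wordProd_append, key]

theorem not_isReduced_pair (u v : List B) (i : B) : ¬cs.IsReduced (u ++ [i, i] ++ v) := by
  intro hr
  have h1 : cs.IsReduced [i, i] := hr.of_append_left.of_append_right
  have := h1.eq
  simp [wordProd_cons] at this

/-- An element is fully commutative if and only if it is `iji`-avoiding. -/
theorem isFullyCommutative_iff_isIjiAvoiding (h : M.IsSimplyLaced) (w : W) :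
    cs.IsFullyCommutative w ↔ cs.IsIjiAvoiding w := by
  constructor
  · rintro hfc ω hω ⟨u, v, i, j, hij, rfl⟩
    have h2 : cs.IsReducedExpr (u ++ [j, i, j] ++ v) w := by
      have hp := cs.wordProd_braid (u := u) (v := v) hij
      refine ⟨?_, hp ▸ hω.2⟩
      have := hω.1
      rw [IsReduced] at this ⊢
      rw [← hp, this]; simp
    classical
    -- Short braid moves only permute letters, whereas `iji` and `jij` contain i a different number
    -- of times.
    have hp := (hfc _ _ hω h2).perm.count_eq i
    have := ne_of_eq_three hij
    simp [this.symm] at hp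
  · intro hav
    obtain ⟨ω, hω, rfl⟩ := cs.exists_isReduced w
    refine IsStable.isFullyCommutative cs h fun ω' hm => ?_
    have hr : cs.IsReducedExpr ω' (cs.wordProd ω) := by
      refine ⟨?_, (hm.wordProd_eq cs).symm⟩
      rw [IsReduced, ← hm.wordProd_eq cs, hω.eq, hm.perm.length_eq]
    refine ⟨fun u v i hi => ?_, fun u v i j hij hi => hav _ hr ⟨u, v, i, j, hij, hi⟩⟩
    exact cs.not_isReduced_pair u v i (hi ▸ hr.1)

end CoxeterSystem

namespace CoxeterSystem

variable {B W : Type*} [Group W] {M : CoxeterMatrix B} (cs : CoxeterSystem M W)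
variable (h : M.IsSimplyLaced)

/-! ### Root sequences and contractible triples -/

theorem rootSeq_append (u v : List B) :
    cs.rootSeq h (u ++ v) =
      cs.rootSeq h v ++ (cs.rootSeq h u).map (cs.reflectionRep h (cs.wordProd v)⁻¹) := by
  induction u with
  | nil => simp [rootSeq]
  | cons i u ih =>
    rw [List.cons_append, rootSeq, ih, rootSeq, List.map_append, List.append_assoc,
      List.map_singleton, wordProd_append, mul_inv_rev, reflectionRep_mul_apply]

theorem length_rootSeq (u : List B) : (cs.rootSeq h u).length = u.length := by
  induction u with
  | nil => rfl
  | cons i u ih => simp [rootSeq, ih]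

theorem rootSeq_triple (i j k : B) :
    cs.rootSeq h [i, j, k] = [M.simpleRoot k, cs.reflectionRep h (cs.simple k) (M.simpleRoot j),
      cs.reflectionRep h (cs.simple k) (cs.reflectionRep h (cs.simple j) (M.simpleRoot i))] := by
  simp [rootSeq, wordProd_cons]

/-- The roots in the root sequence of a reduced expression are inversions. -/
theorem root_mem_inversionSet {u v : List B} {i : B} {w : W}
    (hr : cs.IsReducedExpr (u ++ i :: v) w) :
    cs.reflectionRep h (cs.wordProd v)⁻¹ (M.simpleRoot i) ∈ cs.inversionSet h w := by
  obtain ⟨hr, rfl⟩ := hr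
  have hiv : cs.IsReduced (i :: v) := hr.of_append_right
  have hv : cs.IsReduced v := IsReduced.of_append_right (u := [i]) hiv
  have hui : cs.IsReduced (u ++ [i]) := by
    have : u ++ i :: v = (u ++ [i]) ++ v := by simp
    exact (this ▸ hr).of_append_left
  refine ⟨⟨⟨_, _, rfl⟩, fun k => ?_⟩, ⟨⟨_, i, (cs.reflectionRep_mul_apply h _ _ _).symm⟩, ?_⟩⟩
  · apply nonneg_of_not_isRightDescent
    rw [isRightDescent_inv_iff]
    exact (cs.isReduced_cons_iff hv).1 hiv
  · intro k
    rw [wordProd_append, wordProd_cons, reflectionRep_mul_apply, reflectionRep_mul_apply,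
      reflectionRep_self_apply_inv, simple_apply_self, map_neg, Finsupp.neg_apply, neg_nonpos]
    apply nonneg_of_not_isRightDescent
    rw [not_isRightDescent_iff, hui.of_append_left.eq]
    have := hui.eq
    rw [wordProd_append, wordProd_singleton] at this
    rw [this]; simp

theorem height_add (v v' : B →₀ ℝ) : height (v + v') = height v + height v' :=
  Finsupp.sum_add_index' (fun _ => rfl) (fun _ _ _ => rfl)

theorem height_nonneg {v : B →₀ ℝ} (hv : ∀ i, 0 ≤ v i) : 0 ≤ height v :=
  Finset.sum_nonneg fun i _ => hv i

/-- A factor `i j i` of a reduced expression gives rise to a contractible triple. -/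
theorem isContractibleTriple_of_factor {u v : List B} {i j : B} (hij : M i j = 3) {w : W}
    (hr : cs.IsReducedExpr (u ++ [i, j, i] ++ v) w) :
    ∃ T, cs.IsContractibleTriple h w T ∧
      IsHighestRoot T (cs.reflectionRep h (cs.simple i * cs.wordProd v)⁻¹ (M.simpleRoot j)) ∧
      cs.reflectionRep h (cs.wordProd v)⁻¹ (M.simpleRoot i) ∈ T ∧
      cs.reflectionRep h (cs.wordProd v)⁻¹ (M.simpleRoot j) ∈ T := by
  have hji : M j i = 3 := M.symmetric i j ▸ hij
  -- Read from right to left, the letters of `iji` carry the roots ργ_i, ρ(γ_i + γ_j), ργ_j.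
  set ρ := cs.reflectionRep h (cs.wordProd v)⁻¹ with hρ
  have hmid : cs.reflectionRep h (cs.simple i * cs.wordProd v)⁻¹ (M.simpleRoot j) =
      ρ (M.simpleRoot i) + ρ (M.simpleRoot j) := by
    rw [mul_inv_rev, inv_simple, reflectionRep_mul_apply, simple_apply_of_eq_three _ _ hij,
      map_add, add_comm]
  have hfst : cs.reflectionRep h (cs.wordProd (j :: i :: v))⁻¹ (M.simpleRoot i) =
      ρ (M.simpleRoot j) := by
    rw [wordProd_cons, wordProd_cons, mul_inv_rev, mul_inv_rev, inv_simple, inv_simple,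
      reflectionRep_mul_apply, reflectionRep_mul_apply, simple_apply_of_eq_three _ _ hji,
      map_add, simple_apply_self, simple_apply_of_eq_three _ _ hij]
    simp [hρ]
  have m1 : ρ (M.simpleRoot i) ∈ cs.inversionSet h w :=
    cs.root_mem_inversionSet h (u := u ++ [i, j]) (by simpa using hr)
  have m2 : ρ (M.simpleRoot i) + ρ (M.simpleRoot j) ∈ cs.inversionSet h w := by
    rw [← hmid, ← wordProd_cons]
    exact cs.root_mem_inversionSet h (u := u ++ [i]) (by simpa using hr)
  have m3 : ρ (M.simpleRoot j) ∈ cs.inversionSet h w := by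
    rw [← hfst]
    exact cs.root_mem_inversionSet h (u := u) (by simpa using hr)
  refine ⟨{ρ (M.simpleRoot i), ρ (M.simpleRoot j), ρ (M.simpleRoot i) + ρ (M.simpleRoot j)},
    ⟨⟨?_, _, _, rfl⟩, _, hr, cs.rootSeq h v,
      (cs.rootSeq h u).map (cs.reflectionRep h (cs.wordProd ([i, j, i] ++ v))⁻¹),
      ρ (M.simpleRoot i), ρ (M.simpleRoot i) + ρ (M.simpleRoot j), ρ (M.simpleRoot j),
      ?_, ?_⟩, ⟨?_, ?_⟩, by simp, by simp⟩
  · rintro x (rfl | rfl | rfl) <;> assumption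
  · rw [List.append_assoc, rootSeq_append, rootSeq_append, rootSeq_triple,
      simple_apply_of_eq_three _ _ hij, simple_apply_of_eq_three _ _ hji,
      map_add (cs.reflectionRep h (cs.simple i)), simple_apply_self,
      simple_apply_of_eq_three _ _ hij]
    simp [hρ, add_comm]
  · rw [Set.pair_comm]
  · rw [hmid]; simp
  · have h1 := height_nonneg m1.1.2
    have h3 := height_nonneg m3.1.2
    rw [hmid, height_add]
    rintro x (rfl | rfl | rfl)
    · linarith
    · linarith
    · rw [height_add]

/-- Distinct positions of a reduced word carry distinct roots. -/
theorem root_ne_root {u x v : List B} {i j : B} (hr : cs.IsReduced (u ++ i :: x ++ j :: v)) :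
    cs.reflectionRep h (cs.wordProd (x ++ j :: v))⁻¹ (M.simpleRoot i) ≠
      cs.reflectionRep h (cs.wordProd v)⁻¹ (M.simpleRoot j) := by
  intro he
  have hix : cs.IsReduced (i :: x) := hr.of_append_left.of_append_right
  have hx : cs.IsReduced x := IsReduced.of_append_right (u := [i]) hix
  -- Cancelling v and applying s_j turns equality into x⁻¹γ_i = -γ_j, but x⁻¹γ_i is nonnegative
  -- because ix is reduced.
  rw [wordProd_append, wordProd_cons, mul_inv_rev, mul_inv_rev, inv_simple,
    reflectionRep_mul_apply, reflectionRep_mul_apply] at he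
  have h1 := congrArg (cs.reflectionRep h (cs.simple j)) (cs.reflectionRep_injective h _ he)
  rw [← reflectionRep_mul_apply, simple_mul_simple_self, map_one, Module.End.one_apply,
    simple_apply_self] at h1
  have hd := (cs.isReduced_cons_iff hx).1 hix
  rw [← isRightDescent_inv_iff] at hd
  have h2 := cs.nonneg_of_not_isRightDescent h hd j
  rw [h1] at h2
  norm_num [CoxeterMatrix.simpleRoot] at h2

theorem simple_apply_simpleRoot_of_ne {i j : B} (hij : i ≠ j) :
    ∃ c : ℝ, cs.reflectionRep h (cs.simple j) (M.simpleRoot i) =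
      M.simpleRoot i + c • M.simpleRoot j ∧ (M i j = 3 ∧ c = 1 ∨ c = 0) := by
  rcases h j i hij.symm with hm | hm
  · exact ⟨0, by simp [simple_apply_of_eq_two _ _ hm], .inr rfl⟩
  · exact ⟨1, by simp [simple_apply_of_eq_three _ _ hm], .inl ⟨M.symmetric i j ▸ hm, rfl⟩⟩

/-- Three elements that exhaust `{α, β, α + β}`, one of them the sum of the others. -/
theorem sum_of_triple_eq {V : Type*} [AddCommGroup V] {a b c α β : V} (hab : a ≠ b) (hac : a ≠ c)
    (hbc : b ≠ c) (he : ({α, β, α + β} : Set V) = {a, b, c}) :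
    a = b + c ∨ b = a + c ∨ c = a + b := by
  have hα : α ∈ ({a, b, c} : Set V) := he ▸ by simp
  have hβ : β ∈ ({a, b, c} : Set V) := he ▸ by simp
  have hs : α + β ∈ ({a, b, c} : Set V) := he ▸ by simp
  have ha : a ∈ ({α, β, α + β} : Set V) := he ▸ by simp
  have hb : b ∈ ({α, β, α + β} : Set V) := he ▸ by simp
  have hc : c ∈ ({α, β, α + β} : Set V) := he ▸ by simp
  simp only [Set.mem_insert_iff, Set.mem_singleton_iff] at hα hβ hs ha hb hc
  grind

/-- A contractible triple comes from a factor `i j i`. -/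
theorem exists_factor_of_isContractibleTriple {w : W} {T : Set (B →₀ ℝ)}
    (hT : cs.IsContractibleTriple h w T) :
    ∃ ω u v i j, cs.IsReducedExpr ω w ∧ M i j = 3 ∧ ω = u ++ [i, j, i] ++ v := by
  obtain ⟨⟨-, α, β, hαβ⟩, ω, hω, l₁, l₂, a, b, c, hl, hT⟩ := hT
  have hlen := congrArg List.length hl
  rw [length_rootSeq] at hlen
  simp only [List.length_append, List.length_cons, List.length_nil] at hlen
  obtain ⟨u, x, v, rfl, hx, hv⟩ : ∃ u x v : List B, ω = u ++ x ++ v ∧ x.length = 3 ∧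
      v.length = l₁.length := by
    -- Root sequences read words from right to left, so the final segment l₂ belongs to the prefix
    -- u.
    refine ⟨ω.take l₂.length, (ω.drop l₂.length).take 3, (ω.drop l₂.length).drop 3, ?_, ?_, ?_⟩
    · rw [List.append_assoc, List.take_append_drop, List.take_append_drop]
    · rw [List.length_take, List.length_drop]; omega
    · rw [List.length_drop, List.length_drop]; omega
  obtain ⟨i, j, k, rfl⟩ := List.length_eq_three.1 hx
  rw [List.append_assoc, rootSeq_append, rootSeq_append, List.append_assoc,
    List.append_assoc] at hl
  have hl' := (List.append_inj hl (by rw [length_rootSeq, hv])).2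
  have habc := (List.append_inj hl' (by simp [length_rootSeq])).1
  rw [rootSeq_triple] at habc
  simp only [List.map_cons, List.map_nil, List.cons.injEq, and_true] at habc
  obtain ⟨rfl, rfl, rfl⟩ := habc
  have hr : cs.IsReduced [i, j, k] := hω.1.of_append_left.of_append_right
  have hij : i ≠ j := by
    rintro rfl; exact cs.not_isReduced_pair [] [k] i (by simpa using hr)
  have hne := fun {x y : B →₀ ℝ} (hxy : x ≠ y) =>
    (cs.reflectionRep_injective h (cs.wordProd v)⁻¹).ne hxy
  have n1 := cs.root_ne_root h (u := [i]) (x := []) (v := []) (i := j) (j := k) (by simpa using hr)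
  have n2 := cs.root_ne_root h (u := []) (x := [j]) (v := []) (i := i) (j := k) (by simpa using hr)
  have n3 := cs.root_ne_root h (u := []) (x := []) (v := [k]) (i := i) (j := j) (by simpa using hr)
  simp [wordProd_cons] at n1 n2 n3
  have hs := sum_of_triple_eq (hne (Ne.symm n1)) (hne (Ne.symm n2)) (hne (Ne.symm n3)) (hαβ.symm.trans hT)
  simp only [← map_add, (cs.reflectionRep_injective h (cs.wordProd v)⁻¹).eq_iff] at hs
  obtain ⟨t, ht, htc⟩ := cs.simple_apply_simpleRoot_of_ne h hij
  -- Pulled back by s_k, the three roots become -γ_k, γ_j and γ_i + tγ_j with t = 0 or 1. Comparing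
  -- coefficients of γ_i and γ_j, one of them can be the sum of the others only if i = k and t = 1.
  have hk : M.simpleRoot k = cs.reflectionRep h (cs.simple k) (-M.simpleRoot k) := by
    rw [map_neg, simple_apply_self, neg_neg]
  rw [ht] at hs
  nth_rw 1 [hk] at hs
  nth_rw 2 [hk] at hs
  nth_rw 3 [hk] at hs
  simp only [← map_add, (cs.reflectionRep_injective h (cs.simple k)).eq_iff] at hs
  have ei : ∀ l, M.simpleRoot l l = 1 := fun l => by simp [CoxeterMatrix.simpleRoot]
  have en : ∀ l m, l ≠ m → M.simpleRoot l m = 0 := fun l m hlm => by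
    simp [CoxeterMatrix.simpleRoot, hlm]
  by_cases hik : i = k
  · subst hik
    rcases htc with ⟨hm, -⟩ | rfl
    · exact ⟨_, u, v, i, j, hω, hm, rfl⟩
    · exfalso
      rcases hs with hs | hs | hs
      · have := DFunLike.congr_fun hs i
        simp [ei, en _ _ hij.symm] at this
        linarith
      · have := DFunLike.congr_fun hs j
        simp [ei] at this
      · have := DFunLike.congr_fun hs i
        simp [ei, en _ _ hij.symm] at this
        linarith
  · exfalso
    rcases hs with hs | hs | hs
    all_goals
      have := DFunLike.congr_fun hs i
      simp [ei, en _ _ hij.symm, en _ _ (Ne.symm hik)] at this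

theorem IsIjiAvoiding.isFreelyBraided {w : W} (hw : cs.IsIjiAvoiding w) :
    cs.IsFreelyBraided h w := by
  have hno : ∀ T, ¬cs.IsContractibleTriple h w T := fun T hT => by
    obtain ⟨ω, u, v, i, j, hω, hij, rfl⟩ := cs.exists_factor_of_isContractibleTriple h hT
    exact hw _ hω ⟨u, v, i, j, hij, rfl⟩
  exact ⟨fun T _ hT => (hno T hT).elim, fun T _ hT => (hno T hT).elim⟩

end CoxeterSystem

/-! ### A firing game on graphs

A vertex may fire if at least two neighbours have fired since its last firing. Sequences of
legal firings are stable words. -/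

namespace SimpleGraph

variable {V : Type*} (G : SimpleGraph V)

open Classical in
/-- The state after firing the vertex `i`: its counter is reset, and the counters of its
neighbours increase by one. -/
noncomputable def fire (i : V) (σ : V → ℕ) : V → ℕ :=
  fun j => if j = i then 0 else if G.Adj i j then σ j + 1 else σ j

/-- The sequence of firings `ω` is legal from the state `σ`. -/
def Play : (V → ℕ) → List V → Prop
  | _, [] => True
  | σ, i :: ω => 2 ≤ σ i ∧ Play (G.fire i σ) ω

/-- Some set of states contains the constant state `2` and a legal move from each of its elements
stays in the set. -/
def HasInfinitePlay : Prop :=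
  ∃ Inv : (V → ℕ) → Prop, Inv (fun _ => 2) ∧ ∀ σ, Inv σ → ∃ i, 2 ≤ σ i ∧ Inv (G.fire i σ)

variable {G}

theorem fire_self (i : V) (σ : V → ℕ) : G.fire i σ i = 0 := by simp [fire]

theorem fire_of_adj {i j : V} (hij : G.Adj i j) (σ : V → ℕ) : G.fire i σ j = σ j + 1 := by
  simp [fire, hij, hij.ne']

theorem fire_of_not_adj {i j : V} (hn : j ≠ i) (hij : ¬G.Adj i j) (σ : V → ℕ) :
    G.fire i σ j = σ j := by
  simp [fire, hij, hn]

theorem le_fire {i j : V} (hn : j ≠ i) (σ : V → ℕ) : σ j ≤ G.fire i σ j := by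
  by_cases hij : G.Adj i j
  · rw [fire_of_adj hij]; omega
  · rw [fire_of_not_adj hn hij]

theorem fire_comm {i j : V} (hn : i ≠ j) (hij : ¬G.Adj i j) (σ : V → ℕ) :
    G.fire i (G.fire j σ) = G.fire j (G.fire i σ) := by
  have hji : ¬G.Adj j i := fun hh => hij hh.symm
  funext k
  by_cases h1 : k = i
  · subst h1
    rw [fire_self, fire_of_not_adj hn hji, fire_self]
  by_cases h2 : k = j
  · subst h2
    rw [fire_self, fire_of_not_adj hn.symm hij, fire_self]
  simp only [fire, h1, h2, if_false]
  split_ifs <;> rfl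

/-- τ is the state reached after u. This localises changes made in the middle of a play. -/
theorem Play.append {σ : V → ℕ} {u v : List V} (hp : G.Play σ (u ++ v)) :
    ∃ τ, G.Play τ v ∧ ∀ v', G.Play τ v' → G.Play σ (u ++ v') := by
  induction u generalizing σ with
  | nil => exact ⟨σ, hp, fun _ h => h⟩
  | cons i u ih =>
    obtain ⟨τ, h1, h2⟩ := ih hp.2
    exact ⟨τ, h1, fun v' hv' => ⟨hp.1, h2 v' hv'⟩⟩

theorem HasInfinitePlay.exists_play (hG : G.HasInfinitePlay) (n : ℕ) :
    ∃ ω : List V, ω.length = n ∧ G.Play (fun _ => 2) ω := by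
  obtain ⟨Inv, h0, hs⟩ := hG
  suffices ∀ σ, Inv σ → ∃ ω : List V, ω.length = n ∧ G.Play σ ω from this _ h0
  induction n with
  | zero => exact fun σ _ => ⟨[], rfl, trivial⟩
  | succ n ih =>
    intro σ hσ
    obtain ⟨i, hi, hI⟩ := hs σ hσ
    obtain ⟨ω, hl, hp⟩ := ih _ hI
    exact ⟨i :: ω, by simp [hl], hi, hp⟩

/-- The play is copied along the embedding. Extra edges of H can only raise counters, so it suffices
that the state on H dominates the one on G. -/
theorem HasInfinitePlay.of_isContained {V' : Type*} {H : SimpleGraph V'} (hG : G.HasInfinitePlay)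
    (hGH : G.IsContained H) : H.HasInfinitePlay := by
  obtain ⟨Inv, h0, hs⟩ := hG
  obtain ⟨f⟩ := hGH
  have hf : Function.Injective f := f.injective
  have ha : ∀ {i j}, G.Adj i j → H.Adj (f i) (f j) := fun hij => f.toHom.map_adj hij
  refine ⟨fun σ => ∃ τ, (∀ v, τ v ≤ σ (f v)) ∧ Inv τ, ⟨_, fun _ => le_rfl, h0⟩, ?_⟩
  rintro σ ⟨τ, hτ, hI⟩
  obtain ⟨i, hi, hI'⟩ := hs τ hI
  refine ⟨f i, hi.trans (hτ i), _, fun v => ?_, hI'⟩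
  by_cases hv : v = i
  · subst hv; rw [fire_self]; exact Nat.zero_le _
  by_cases hv' : G.Adj i v
  · rw [fire_of_adj hv', fire_of_adj (ha hv')]
    exact Nat.succ_le_succ (hτ v)
  · rw [fire_of_not_adj hv hv']
    exact (hτ v).trans (le_fire (hf.ne hv) σ)

/-- A periodic play on a finite graph, given by a table of states. -/
theorem hasInfinitePlay_of_table {n N : ℕ} [NeZero N] (adj : Fin n → Fin n → Bool)
    (x : Fin N → Fin n) (st : Fin N → Fin n → ℕ) (hst : ∀ v, st 0 v ≤ 2)
    (hx : ∀ r, 2 ≤ st r (x r))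
    (hstep : ∀ r v, st (r + 1) v ≤
      if v = x r then 0 else if adj (x r) v then st r v + 1 else st r v)
    (f : Fin n → V) (hf : Function.Injective f)
    (ha : ∀ i j, adj i j → G.Adj (f i) (f j)) : G.HasInfinitePlay := by
  refine ⟨fun σ => ∃ r, ∀ v, st r v ≤ σ (f v), ⟨0, hst⟩, ?_⟩
  rintro σ ⟨r, hr⟩
  refine ⟨f (x r), (hx r).trans (hr _), r + 1, fun v => (hstep r v).trans ?_⟩
  split_ifs with h1 h2
  · exact Nat.zero_le _
  · rw [fire_of_adj (ha _ _ h2)]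
    exact Nat.succ_le_succ (hr v)
  · exact (hr v).trans (le_fire (hf.ne h1) σ)

/-- A graph with three disjoint paths of length two that start at a common vertex. -/
theorem hasInfinitePlay_of_arms_two {b x₁ x₂ x₃ y₁ y₂ y₃ : V}
    (hn : [b, x₁, x₂, x₃, y₁, y₂, y₃].Nodup)
    (h₁ : G.Adj b x₁) (h₂ : G.Adj b x₂) (h₃ : G.Adj b x₃) (h₄ : G.Adj x₁ y₁) (h₅ : G.Adj x₂ y₂)
    (h₆ : G.Adj x₃ y₃) : G.HasInfinitePlay := by
  let E : List (Fin 7 × Fin 7) := [(0, 1), (0, 2), (0, 3), (1, 4), (2, 5), (3, 6)]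
  -- The graph is affine E6. In a period each vertex fires as often as its coefficient in the null
  -- root: 3 for the centre, then 2 and 1 along each arm, 12 in all. Row r bounds the counters
  -- before firing r from below.
  refine hasInfinitePlay_of_table (n := 7) (N := 12)
    (fun i j => decide ((i, j) ∈ E) || decide ((j, i) ∈ E))
    ![4, 1, 0, 2, 5, 6, 3, 0, 1, 2, 0, 3]
    ![![1, 1, 1, 0, 2, 1, 2], ![1, 2, 1, 0, 0, 1, 2], ![2, 0, 1, 0, 1, 1, 2],
      ![0, 1, 2, 1, 1, 1, 2], ![1, 1, 0, 1, 1, 2, 2], ![1, 1, 1, 1, 1, 0, 2],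
      ![1, 1, 1, 2, 1, 0, 0], ![2, 1, 1, 0, 1, 0, 1], ![0, 2, 2, 1, 1, 0, 1],
      ![1, 0, 2, 1, 2, 0, 1], ![2, 0, 0, 1, 2, 1, 1], ![0, 1, 1, 2, 2, 1, 1]]
    (by decide) (by decide) (by decide) (fun i => [b, x₁, x₂, x₃, y₁, y₂, y₃].get i)
    (List.nodup_iff_injective_get.1 hn) ?_
  have key : ∀ p ∈ E, G.Adj ([b, x₁, x₂, x₃, y₁, y₂, y₃].get p.1)
      ([b, x₁, x₂, x₃, y₁, y₂, y₃].get p.2) := by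
    simp [E, h₁, h₂, h₃, h₄, h₅, h₆]
  intro i j hij
  rw [Bool.or_eq_true, decide_eq_true_iff, decide_eq_true_iff] at hij
  exact hij.elim (fun hm => key _ hm) fun hm => (key _ hm).symm

/-- A graph with disjoint paths of lengths one, three and three that start at a common vertex. -/
theorem hasInfinitePlay_of_arms_one_three_three {b q x₁ x₂ y₁ y₂ z₁ z₂ : V}
    (hn : [b, q, x₁, x₂, y₁, y₂, z₁, z₂].Nodup)
    (h₁ : G.Adj b q) (h₂ : G.Adj b x₁) (h₃ : G.Adj b x₂) (h₄ : G.Adj x₁ y₁) (h₅ : G.Adj x₂ y₂)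
    (h₆ : G.Adj y₁ z₁) (h₇ : G.Adj y₂ z₂) : G.HasInfinitePlay := by
  let E : List (Fin 8 × Fin 8) := [(0, 1), (0, 2), (0, 3), (2, 4), (3, 5), (4, 6), (5, 7)]
  -- The graph is affine E7, with null root coefficients 4 at the centre, 2 at `q`, and 3, 2, 1
  -- along the long arms, 18 in all.
  refine hasInfinitePlay_of_table (n := 8) (N := 18)
    (fun i j => decide ((i, j) ∈ E) || decide ((j, i) ∈ E))
    ![1, 2, 0, 3, 5, 6, 4, 2, 0, 1, 3, 0, 2, 4, 7, 5, 3, 0]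
    ![![0, 2, 2, 1, 0, 1, 2, 1], ![1, 0, 2, 1, 0, 1, 2, 1], ![2, 0, 0, 1, 1, 1, 2, 1],
      ![0, 1, 1, 2, 1, 1, 2, 1], ![1, 1, 1, 0, 1, 2, 2, 1], ![1, 1, 1, 1, 1, 0, 2, 2],
      ![1, 1, 1, 1, 2, 0, 0, 2], ![1, 1, 2, 1, 0, 0, 1, 2], ![2, 1, 0, 1, 1, 0, 1, 2],
      ![0, 2, 1, 2, 1, 0, 1, 2], ![1, 0, 1, 2, 1, 0, 1, 2], ![2, 0, 1, 0, 1, 1, 1, 2],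
      ![0, 1, 2, 1, 1, 1, 1, 2], ![1, 1, 0, 1, 2, 1, 1, 2], ![1, 1, 1, 1, 0, 1, 2, 2],
      ![1, 1, 1, 1, 0, 2, 2, 0], ![1, 1, 1, 2, 0, 0, 2, 1], ![2, 1, 1, 0, 0, 1, 2, 1]]
    (by decide) (by decide) (by decide) (fun i => [b, q, x₁, x₂, y₁, y₂, z₁, z₂].get i)
    (List.nodup_iff_injective_get.1 hn) ?_
  have key : ∀ p ∈ E, G.Adj ([b, q, x₁, x₂, y₁, y₂, z₁, z₂].get p.1)
      ([b, q, x₁, x₂, y₁, y₂, z₁, z₂].get p.2) := by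
    simp [E, h₁, h₂, h₃, h₄, h₅, h₆, h₇]
  intro i j hij
  rw [Bool.or_eq_true, decide_eq_true_iff, decide_eq_true_iff] at hij
  exact hij.elim (fun hm => key _ hm) fun hm => (key _ hm).symm

/-- A graph that contains a cycle. -/
theorem hasInfinitePlay_of_cycle {c : ℕ → V} {m : ℕ} (hm : 2 ≤ m)
    (hc : ∀ s t, s ≤ m → t ≤ m → c s = c t → s = t) (ha : ∀ t, t < m → G.Adj (c t) (c (t + 1)))
    (hl : G.Adj (c m) (c 0)) : G.HasInfinitePlay := by
  -- The firing runs round the cycle: c t is ready, and only its predecessor, which has just fired,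
  -- may have counter 0.
  refine ⟨fun σ => ∃ t ≤ m, 2 ≤ σ (c t) ∧
    ∀ s ≤ m, s ≠ t → s + 1 ≠ t → ¬(t = 0 ∧ s = m) → 1 ≤ σ (c s),
    ⟨0, Nat.zero_le _, le_rfl, fun _ _ _ _ _ => by norm_num⟩, ?_⟩
  rintro σ ⟨t, htm, ht, hs⟩
  refine ⟨c t, ht, ?_⟩
  have hge : ∀ s ≤ m, s ≠ t → σ (c s) ≤ G.fire (c t) σ (c s) := fun s hsm hst =>
    le_fire (fun he => hst (hc _ _ hsm htm he)) σ
  have hinc : ∀ s, G.Adj (c t) (c s) → G.fire (c t) σ (c s) = σ (c s) + 1 := fun s hst =>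
    fire_of_adj hst σ
  rcases htm.lt_or_eq with hlt | rfl
  · refine ⟨t + 1, hlt, ?_, fun s hsm h1 h2 h3 => ?_⟩
    · have := hs (t + 1) hlt (by omega) (by omega) (by omega)
      rw [hinc _ (ha t hlt)]; omega
    · by_cases h4 : s + 1 = t
      · subst h4
        rw [hinc _ (ha s (by omega)).symm]; omega
      by_cases h5 : t = 0 ∧ s = m
      · obtain ⟨rfl, rfl⟩ := h5
        rw [hinc _ hl.symm]; omega
      exact (hs s hsm (by omega) h4 h5).trans (hge s hsm (by omega))
  · refine ⟨0, Nat.zero_le _, ?_, fun s hsm h1 h2 h3 => ?_⟩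
    · have := hs 0 (Nat.zero_le _) (by omega) (by omega) (by omega)
      rw [hinc _ hl]; omega
    · by_cases h4 : s + 1 = t
      · subst h4
        rw [hinc _ (ha s (by omega)).symm]; omega
      exact (hs s hsm (by omega) h4 (by omega)).trans (hge s hsm (by omega))

/-- The path `p 0, …, p k`, with two more neighbours `a`, `a'` of `p 0` and two more neighbours
`c`, `c'` of `p k`. -/
structure IsForkedPath (G : SimpleGraph V) (k : ℕ) (a a' : V) (p : ℕ → V) (c c' : V) : Prop where
  inj : ∀ s t, s ≤ k → t ≤ k → p s = p t → s = t
  adj : ∀ t, t < k → G.Adj (p t) (p (t + 1))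
  adj_a : G.Adj (p 0) a
  adj_a' : G.Adj (p 0) a'
  adj_c : G.Adj (p k) c
  adj_c' : G.Adj (p k) c'
  nodup : [a, a', c, c'].Nodup
  notMem : ∀ t ≤ k, p t ∉ [a, a', c, c']

theorem IsForkedPath.reverse {k : ℕ} {a a' c c' : V} {p : ℕ → V}
    (hp : G.IsForkedPath k a a' p c c') :
    G.IsForkedPath k c c' (fun t => p (k - t)) a a' where
  inj s t hs ht he := by
    have := hp.inj _ _ (by omega) (by omega) he
    omega
  adj t ht := by
    have := hp.adj (k - (t + 1)) (by omega)
    rw [show k - (t + 1) + 1 = k - t by omega] at this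
    exact this.symm
  adj_a := by simpa using hp.adj_c
  adj_a' := by simpa using hp.adj_c'
  adj_c := by simpa using hp.adj_a
  adj_c' := by simpa using hp.adj_a'
  nodup := by
    have := hp.nodup
    simp only [List.nodup_cons, List.mem_cons, List.not_mem_nil, or_false, not_or,
      List.nodup_nil, and_true, not_false_eq_true] at this ⊢
    obtain ⟨⟨h1, h2, h3⟩, ⟨h4, h5⟩, h6⟩ := this
    exact ⟨⟨h6, Ne.symm h2, Ne.symm h4⟩, ⟨Ne.symm h3, Ne.symm h5⟩, h1⟩
  notMem t ht := by
    have := hp.notMem (k - t) (by omega)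
    simp only [List.mem_cons, List.not_mem_nil, or_false, not_or] at this ⊢
    tauto

/-- A graph with two branch vertices, or a vertex of degree four. -/
theorem IsForkedPath.hasInfinitePlay {k : ℕ} {a a' c c' : V} {p : ℕ → V}
    (hp : G.IsForkedPath k a a' p c c') : G.HasInfinitePlay := by
  -- A wave fires a, then a', then p 0, …, p k, which makes c and c' ready; it then runs back along
  -- the reversed path. The three alternatives are the phases in which a, a' or p t is the next to
  -- fire.
  refine ⟨fun σ => ∃ a a' p c c', G.IsForkedPath k a a' p c c' ∧ 1 ≤ σ c ∧ 1 ≤ σ c' ∧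
    (2 ≤ σ a ∧ 2 ≤ σ a' ∧ (∀ t ≤ k, t ≠ 0 → 1 ≤ σ (p t)) ∨
      2 ≤ σ a' ∧ (∀ t ≤ k, 1 ≤ σ (p t)) ∨
      ∃ t ≤ k, 2 ≤ σ (p t) ∧ (∀ s ≤ k, s ≠ t → s + 1 ≠ t → 1 ≤ σ (p s)) ∧
        (t ≠ 0 → 1 ≤ σ a ∧ 1 ≤ σ a')),
    ⟨a, a', p, c, c', hp, by norm_num, by norm_num, .inl ⟨le_rfl, le_rfl, fun _ _ _ => by norm_num⟩⟩,
    ?_⟩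
  rintro σ ⟨a, a', p, c, c', hp, hc, hc', hσ⟩
  have hn := hp.nodup
  have hm := hp.notMem
  simp only [List.nodup_cons, List.mem_cons, List.not_mem_nil, or_false, not_or,
    List.nodup_nil, and_true, not_false_eq_true] at hn hm
  obtain ⟨⟨n1, n2, n3⟩, ⟨n4, n5⟩, n6⟩ := hn
  rcases hσ with ⟨ha, ha', hs⟩ | ⟨ha', hs⟩ | ⟨t, htk, ht, hs, hta⟩
  · refine ⟨a, ha, a, a', p, c, c', hp, hc.trans (le_fire (Ne.symm n2) σ),
      hc'.trans (le_fire (Ne.symm n3) σ), .inr (.inl ⟨ha'.trans (le_fire (Ne.symm n1) σ),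
      fun t htk => ?_⟩)⟩
    by_cases h0 : t = 0
    · subst h0; rw [fire_of_adj hp.adj_a.symm]; omega
    · exact (hs t htk h0).trans (le_fire (hm t htk).1 σ)
  · refine ⟨a', ha', a, a', p, c, c', hp, hc.trans (le_fire (Ne.symm n4) σ),
      hc'.trans (le_fire (Ne.symm n5) σ), .inr (.inr ⟨0, Nat.zero_le _, ?_, fun s hsk _ _ => ?_,
      fun h => absurd rfl h⟩)⟩
    · have := hs 0 (Nat.zero_le _)
      rw [fire_of_adj hp.adj_a'.symm]; omega
    · exact (hs s hsk).trans (le_fire (hm s hsk).2.1 σ)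
  · refine ⟨p t, ht, ?_⟩
    have hpa : 1 ≤ G.fire (p t) σ a ∧ 1 ≤ G.fire (p t) σ a' := by
      by_cases h0 : t = 0
      · subst h0
        rw [fire_of_adj hp.adj_a, fire_of_adj hp.adj_a']; omega
      · exact ⟨(hta h0).1.trans (le_fire (Ne.symm (hm t htk).1) σ),
          (hta h0).2.trans (le_fire (Ne.symm (hm t htk).2.1) σ)⟩
    have hps : ∀ s ≤ k, s ≠ t → 1 ≤ G.fire (p t) σ (p s) := by
      intro s hsk hst
      by_cases h1 : s + 1 = t
      · subst h1
        rw [fire_of_adj (hp.adj s (by omega)).symm]; omega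
      · exact (hs s hsk hst h1).trans (le_fire (fun he => hst (hp.inj _ _ hsk htk he)) σ)
    rcases htk.lt_or_eq with hlt | rfl
    · refine ⟨a, a', p, c, c', hp, hc.trans (le_fire (Ne.symm (hm t htk).2.2.1) σ),
        hc'.trans (le_fire (Ne.symm (hm t htk).2.2.2) σ), .inr (.inr ⟨t + 1, hlt, ?_,
        fun s hsk _ h2 => hps s hsk (by omega), fun _ => hpa⟩)⟩
      have := hs (t + 1) hlt (by omega) (by omega)
      rw [fire_of_adj (hp.adj t hlt)]; omega
    · refine ⟨c, c', _, a, a', hp.reverse, hpa.1, hpa.2, .inl ⟨?_, ?_, fun s hsk h0 => ?_⟩⟩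
      · rw [fire_of_adj hp.adj_c]; omega
      · rw [fire_of_adj hp.adj_c']; omega
      · exact hps _ (by omega) (by omega)

end SimpleGraph

/-! ### Fully commutative elements from legal firing sequences -/

namespace CoxeterSystem

variable {B W : Type*} [Group W] {M : CoxeterMatrix B} (cs : CoxeterSystem M W)

/-- Legality survives swaps of commuting letters. In a factor `ii` the second i would fire with
counter 0, and in `iji` with counter 1. -/
theorem isStable_of_play {σ : B → ℕ} {ω : List B} (hp : M.coxeterGraph.Play σ ω) :
    IsStable M ω := by
  intro ω' hm
  have hp' : M.coxeterGraph.Play σ ω' := by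
    induction hm with
    | refl => exact hp
    | tail _ h1 ih =>
      obtain ⟨u, v, i, j, hij, rfl, rfl⟩ := h1
      rw [List.append_assoc] at ih ⊢
      obtain ⟨τ, h1, h2⟩ := ih.append
      apply h2
      have hn : i ≠ j := by rintro rfl; rw [M.diagonal] at hij; omega
      have hna : ¬M.coxeterGraph.Adj i j := fun hh => by
        have := hh.2; omega
      have hna' : ¬M.coxeterGraph.Adj j i := fun hh => hna hh.symm
      obtain ⟨h3, h4, h5⟩ := h1
      rw [SimpleGraph.fire_of_not_adj hn.symm hna] at h4
      refine ⟨h4, ?_, ?_⟩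
      · rw [SimpleGraph.fire_of_not_adj hn hna']; exact h3
      · rw [SimpleGraph.fire_comm hn hna]; exact h5
  constructor
  · rintro u v i rfl
    rw [List.append_assoc] at hp'
    obtain ⟨τ, ⟨-, h2, -⟩, -⟩ := hp'.append
    rw [SimpleGraph.fire_self] at h2
    omega
  · rintro u v i j hij rfl
    rw [List.append_assoc] at hp'
    obtain ⟨τ, ⟨-, -, h2, -⟩, -⟩ := hp'.append
    have hn := ne_of_eq_three hij
    have hadj : M.coxeterGraph.Adj j i := ⟨hn.symm, M.symmetric i j ▸ hij⟩
    rw [SimpleGraph.fire_of_adj hadj, SimpleGraph.fire_self] at h2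
    omega

theorem infinite_fullyCommutative_of_hasInfinitePlay (h : M.IsSimplyLaced)
    (hG : M.coxeterGraph.HasInfinitePlay) : {w : W | cs.IsFullyCommutative w}.Infinite := by
  refine Set.Infinite.of_image cs.length ?_
  refine Set.infinite_of_forall_exists_gt fun n => ?_
  obtain ⟨ω, hl, hp⟩ := hG.exists_play (n + 1)
  have hs := isStable_of_play hp
  refine ⟨_, ⟨_, hs.isFullyCommutative cs h, rfl⟩, ?_⟩
  rw [(hs.isReduced_and_equiv cs h).1.eq]
  omega

/-- The generators themselves are fully commutative, and they are distinct because they act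
differently on simple roots. -/
theorem infinite_fullyCommutative_of_infinite (h : M.IsSimplyLaced) [Infinite B] :
    {w : W | cs.IsFullyCommutative w}.Infinite := by
  have hinj : Function.Injective cs.simple := by
    intro i j hij
    by_contra hn
    have h1 := cs.simple_apply_self h i
    obtain ⟨c, h2, -⟩ := cs.simple_apply_simpleRoot_of_ne h hn
    rw [hij, h2] at h1
    have h3 := DFunLike.congr_fun h1 i
    simp [CoxeterMatrix.simpleRoot, Ne.symm hn] at h3
    norm_num at h3
  refine Set.infinite_of_injective_forall_mem hinj fun i => ?_
  have : cs.simple i = cs.wordProd [i] := by simp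
  change cs.IsFullyCommutative (cs.simple i)
  rw [this]
  exact IsStable.isFullyCommutative cs h (isStable_of_play (σ := fun _ => 2) ⟨le_rfl, trivial⟩)

end CoxeterSystem

/-! ### Graphs without infinite plays -/

namespace SimpleGraph

variable {V : Type*} {G : SimpleGraph V}

theorem isContained_coxeterGraphE {g : V → ℕ} (hg : Function.Injective g) {n : ℕ}
    (hlt : ∀ v, g v < n)
    (hadj : ∀ v w, G.Adj v w → g v < g w → 1 ≤ g v ∧ g v + 1 = g w ∨ g v = 0 ∧ g w = 3) :
    G.IsContained (coxeterGraphE n) := by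
  refine ⟨⟨⟨fun v => ⟨g v, hlt v⟩, fun {v w} hvw => ?_⟩, fun v w he => hg (Fin.mk.inj_iff.1 he)⟩⟩
  rw [coxeterGraphE, SimpleGraph.fromRel_adj]
  have hne : g v ≠ g w := hg.ne hvw.ne
  refine ⟨fun he => hne (Fin.mk.inj_iff.1 he), ?_⟩
  rcases hne.lt_or_gt with hl | hl
  · exact .inl (hadj v w hvw hl)
  · exact .inr (hadj w v hvw.symm hl)

theorem Connected.exists_adj_boundary (hG : G.Connected) {S : Set V} {v w : V} (hv : v ∈ S)
    (hw : w ∉ S) : ∃ a ∈ S, ∃ b ∉ S, G.Adj a b := by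
  obtain ⟨p⟩ := hG.preconnected v w
  obtain ⟨d, -, h1, h2⟩ := p.exists_boundary_dart S hv hw
  exact ⟨d.fst, h1, d.snd, h2, d.adj⟩

/-- The vertices `p 0, …, p L` are distinct, and consecutive ones are adjacent. -/
structure IsPathSeq (G : SimpleGraph V) (p : ℕ → V) (L : ℕ) : Prop where
  inj : ∀ s t, s ≤ L → t ≤ L → p s = p t → s = t
  adj : ∀ t, t < L → G.Adj (p t) (p (t + 1))

namespace IsPathSeq

variable {p : ℕ → V} {L : ℕ}

theorem reverse (hp : G.IsPathSeq p L) : G.IsPathSeq (fun t => p (L - t)) L where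
  inj s t hs ht he := by
    have := hp.inj _ _ (by omega) (by omega) he
    omega
  adj t ht := by
    have := hp.adj (L - (t + 1)) (by omega)
    rw [show L - (t + 1) + 1 = L - t by omega] at this
    exact this.symm

theorem length_lt_card [Finite V] (hp : G.IsPathSeq p L) : L < Nat.card V := by
  have : Function.Injective fun t : Fin (L + 1) => p t := fun s t he =>
    Fin.ext (hp.inj _ _ (by omega) (by omega) he)
  simpa using Nat.card_le_card_of_injective _ this

theorem exists_longest [Finite V] [Nonempty V] :
    ∃ p L, G.IsPathSeq p L ∧ ∀ p' L', G.IsPathSeq p' L' → L' ≤ L := by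
  classical
  let P : ℕ → Prop := fun L => ∃ p, G.IsPathSeq p L
  have h0 : P 0 := ⟨fun _ => Classical.arbitrary V, ⟨fun s t hs ht _ => by omega,
    fun t ht => by omega⟩⟩
  obtain ⟨p, hp⟩ := Nat.findGreatest_spec (P := P) (Nat.zero_le (Nat.card V)) h0
  refine ⟨p, _, hp, fun p' L' hp' => ?_⟩
  exact Nat.le_findGreatest hp'.length_lt_card.le ⟨p', hp'⟩

theorem cons (hp : G.IsPathSeq p L) {q : V} (hq : ∀ t ≤ L, p t ≠ q) (ha : G.Adj q (p 0)) :
    G.IsPathSeq (fun t => if t = 0 then q else p (t - 1)) (L + 1) where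
  inj s t hs ht he := by
    split_ifs at he with h1 h2 h2
    · omega
    · exact absurd he.symm (hq _ (by omega))
    · exact absurd he (hq _ (by omega))
    · have := hp.inj _ _ (by omega) (by omega) he
      omega
  adj t ht := by
    rcases t with - | t
    · simpa using ha
    · simpa using hp.adj t (by omega)

theorem drop (hp : G.IsPathSeq p L) (i : ℕ) (hi : i ≤ L) :
    G.IsPathSeq (fun t => p (i + t)) (L - i) where
  inj s t hs ht he := by
    have := hp.inj _ _ (by omega) (by omega) he
    omega
  adj t ht := hp.adj (i + t) (by omega)

/-- In a graph without infinite plays, a path is an induced subgraph. -/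
theorem eq_succ_of_adj (hp : G.IsPathSeq p L) (hG : ¬G.HasInfinitePlay) {s t : ℕ} (hst : s < t)
    (ht : t ≤ L) (ha : G.Adj (p s) (p t)) : t = s + 1 := by
  by_contra hne
  refine hG (hasInfinitePlay_of_cycle (c := fun u => p (s + u)) (m := t - s) (by omega)
    (fun u v hu hv he => ?_) (fun u hu => hp.adj (s + u) (by omega)) ?_)
  · have := hp.inj _ _ (by omega) (by omega) he
    omega
  · simpa [show s + (t - s) = t by omega] using ha.symm

/-- In a graph without infinite plays, a vertex off a path has at most one neighbour on it. -/
theorem not_adj_of_adj (hp : G.IsPathSeq p L) (hG : ¬G.HasInfinitePlay) {q : V}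
    (hq : ∀ t ≤ L, p t ≠ q) {s t : ℕ} (hst : s < t) (ht : t ≤ L) (has : G.Adj q (p s)) :
    ¬G.Adj q (p t) := by
  intro hat
  have h1 := (hp.drop s (by omega)).cons (fun u hu => hq _ (by omega)) has
  have := h1.eq_succ_of_adj hG (s := 0) (t := t - s + 1) (by omega) (by omega)
    (by simpa [show s + (t - s) = t by omega] using hat)
  omega

/-- Two vertices attached to interior vertices of a path. -/
theorem hasInfinitePlay_of_branches (hp : G.IsPathSeq p L) {q r : V} (hq : ∀ t ≤ L, p t ≠ q)
    (hr : ∀ t ≤ L, p t ≠ r) (hqr : q ≠ r) {i j : ℕ} (hi : 1 ≤ i) (hij : i ≤ j) (hj : j + 1 ≤ L)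
    (hiq : G.Adj (p i) q) (hjr : G.Adj (p j) r) : G.HasInfinitePlay := by
  have hne : ∀ {s t}, s ≤ L → t ≤ L → s ≠ t → p s ≠ p t := fun hs ht hst he =>
    hst (hp.inj _ _ hs ht he)
  have hji : i + (j - i) = j := by omega
  refine IsForkedPath.hasInfinitePlay (k := j - i) (a := q) (a' := p (i - 1))
    (p := fun t => p (i + t)) (c := r) (c' := p (j + 1)) ⟨?_, ?_, ?_, ?_, ?_, ?_, ?_, ?_⟩
  · intro s t hs ht he
    have := hp.inj _ _ (by omega) (by omega) he
    omega
  · exact fun t ht => hp.adj (i + t) (by omega)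
  · exact hiq
  · have := (hp.adj (i - 1) (by omega)).symm
    rwa [Nat.sub_add_cancel hi] at this
  · rwa [hji]
  · rw [hji]; exact hp.adj j (by omega)
  · simp only [List.nodup_cons, List.mem_cons, List.not_mem_nil, or_false, not_or,
      List.nodup_nil, and_true, not_false_eq_true]
    exact ⟨⟨Ne.symm (hq _ (by omega)), hqr, Ne.symm (hq _ (by omega))⟩,
      ⟨hr _ (by omega), hne (by omega) (by omega) (by omega)⟩, Ne.symm (hr _ (by omega))⟩
  · intro t ht
    simp only [List.mem_cons, List.not_mem_nil, or_false, not_or]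
    exact ⟨hq _ (by omega), hne (by omega) (by omega) (by omega), hr _ (by omega),
      hne (by omega) (by omega) (by omega)⟩

/-- A path with one more vertex, attached near the start of the path. -/
theorem isContained_of_vertex (hp : G.IsPathSeq p L) (hG : ¬G.HasInfinitePlay) {q : V}
    (hq : ∀ t ≤ L, p t ≠ q) (hcov : ∀ v, v = q ∨ ∃ t ≤ L, p t = v) {i : ℕ} (hi1 : 1 ≤ i)
    (hi2 : i ≤ 2) (hiL : i ≤ L) (ha : G.Adj q (p i)) :
    ∃ n, 6 ≤ n ∧ G.IsContained (coxeterGraphE n) := by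
  classical
  have hcov' : ∀ v, ∃ t, v ≠ q → t ≤ L ∧ p t = v := fun v => by
    rcases hcov v with rfl | ⟨t, ht⟩
    · exact ⟨0, fun hh => absurd rfl hh⟩
    · exact ⟨t, fun _ => ht⟩
  choose idx hidx using hcov'
  -- The shift by 3 - i puts p i at the branch vertex 3; for i = 1 the label 1 stays unused. The
  -- size L + 6 merely exceeds all labels and is at least 6.
  refine ⟨L + 6, by omega, isContained_coxeterGraphE
    (g := fun v => if v = q then 0 else idx v + (3 - i)) ?_ ?_ ?_⟩
  · intro v w he
    dsimp only at he
    split_ifs at he with h1 h2 h2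
    · rw [h1, h2]
    · omega
    · omega
    · rw [← (hidx v h1).2, ← (hidx w h2).2, show idx v = idx w by omega]
  · intro v
    split_ifs with h1
    · omega
    · have := (hidx v h1).1
      omega
  · intro v w hvw hlt
    split_ifs at hlt ⊢ with h1 h2 h2
    · exact absurd hvw (by rw [h1, h2]; exact G.loopless.irrefl _)
    · right
      obtain ⟨h3, h4⟩ := hidx w h2
      rw [h1, ← h4] at hvw
      refine ⟨rfl, ?_⟩
      rcases lt_trichotomy (idx w) i with h5 | h5 | h5
      · exact absurd ha (hp.not_adj_of_adj hG hq h5 hiL hvw)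
      · omega
      · exact absurd hvw (hp.not_adj_of_adj hG hq h5 h3 ha)
    · omega
    · left
      obtain ⟨h3, h4⟩ := hidx v h1
      obtain ⟨h5, h6⟩ := hidx w h2
      rw [← h4, ← h6] at hvw
      have := hp.eq_succ_of_adj hG (by omega) h5 hvw
      omega

end IsPathSeq

/-- A finite connected graph without infinite plays is a subgraph of a graph of type `E`. -/
theorem exists_isContained_coxeterGraphE [Finite V] (hc : G.Connected)
    (hG : ¬G.HasInfinitePlay) : ∃ n, 6 ≤ n ∧ G.IsContained (coxeterGraphE n) := by
  classical
  have := hc.nonempty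
  obtain ⟨p, L, hp, hmax⟩ := IsPathSeq.exists_longest (G := G)
  let S : Set V := {v | ∃ t ≤ L, p t = v}
  have h0S : p 0 ∈ S := ⟨0, Nat.zero_le _, rfl⟩
  have hoff : ∀ {q}, q ∉ S → ∀ t ≤ L, p t ≠ q := fun hq t ht he => hq ⟨t, ht, he⟩
  -- A neighbour of an end of the longest path would extend it.
  have hend : ∀ {q i}, q ∉ S → i ≤ L → G.Adj q (p i) → 1 ≤ i ∧ i + 1 ≤ L := by
    intro q i hq hi ha
    constructor
    · by_contra h0
      obtain rfl : i = 0 := by omega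
      have := hmax _ _ (hp.cons (hoff hq) ha)
      omega
    · by_contra h0
      obtain rfl : i = L := by omega
      have := hmax _ _ (hp.reverse.cons (fun t _ => hoff hq _ (by omega)) (by simpa using ha))
      omega
  by_cases hS : ∀ v, v ∈ S
  · choose idx hidx using hS
    refine ⟨L + 6, by omega, isContained_coxeterGraphE (g := fun v => idx v + 1) ?_ ?_ ?_⟩
    · intro v w he
      rw [← (hidx v).2, ← (hidx w).2, show idx v = idx w by simpa using he]
    · intro v
      have := (hidx v).1
      omega
    · intro v w hvw hlt
      left
      rw [← (hidx v).2, ← (hidx w).2] at hvw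
      have := hp.eq_succ_of_adj hG (by omega) (hidx w).1 hvw
      omega
  push Not at hS
  obtain ⟨v₀, hv₀⟩ := hS
  obtain ⟨_, ⟨i, hiL, rfl⟩, q, hq, hiq⟩ := hc.exists_adj_boundary h0S hv₀
  obtain ⟨hi1, hi2⟩ := hend hq hiL hiq.symm
  have hne : ∀ {s t}, s ≤ L → t ≤ L → s ≠ t → p s ≠ p t := fun hs ht hst he =>
    hst (hp.inj _ _ hs ht he)
  have hqp : ∀ {t}, t ≤ L → p t ≠ q := fun ht => hoff hq _ ht
  -- A further vertex yields some r adjacent to q or to the path. If r is adjacent to q, maximality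
  -- of the path gives both arms at p i length at least two, and affine E6 appears; if r is adjacent
  -- to some p j, a forked path appears.
  have hcov : ∀ v, v = q ∨ v ∈ S := by
    by_contra hcon
    push Not at hcon
    obtain ⟨v, hvq, hvS⟩ := hcon
    obtain ⟨a, ha, r, hr, har⟩ := hc.exists_adj_boundary (S := insert q S) (w := v)
      (Set.mem_insert_of_mem _ h0S) (by simp [hvq, hvS])
    rw [Set.mem_insert_iff, not_or] at hr
    obtain ⟨hrq, hrS⟩ := hr
    have hrp : ∀ {t}, t ≤ L → p t ≠ r := fun ht => hoff hrS _ ht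
    rcases ha with rfl | ⟨j, hjL, rfl⟩
    · have hi3 : 2 ≤ i := by
        by_contra h1
        obtain rfl : i = 1 := by omega
        have e1 := (hp.drop 1 hiL).cons (fun u hu => hoff hq _ (by omega)) (by simpa using hiq.symm)
        have e2 := e1.cons (q := r) (fun u hu => by
          split_ifs
          · exact Ne.symm hrq
          · exact hrp (by omega)) (by simpa using har.symm)
        have := hmax _ _ e2
        omega
      have hi4 : i + 2 ≤ L := by
        by_contra h1
        obtain rfl : L = i + 1 := by omega
        have e1 := (hp.reverse.drop 1 (by omega)).cons (fun u hu => hoff hq _ (by omega))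
          (by simpa using hiq.symm)
        have e2 := e1.cons (q := r) (fun u hu => by
          split_ifs
          · exact Ne.symm hrq
          · exact hrp (by omega)) (by simpa using har.symm)
        have := hmax _ _ e2
        omega
      obtain ⟨i, rfl⟩ := Nat.exists_eq_add_of_le' hi3
      refine hG (hasInfinitePlay_of_arms_two (b := p (i + 2)) (x₁ := p (i + 1)) (x₂ := p (i + 3))
        (x₃ := a) (y₁ := p i) (y₂ := p (i + 4)) (y₃ := r) ?_ (hp.adj (i + 1) (by omega)).symm
        (hp.adj (i + 2) (by omega)) hiq (hp.adj i (by omega)).symm (hp.adj (i + 3) (by omega)) har)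
      simp only [List.nodup_cons, List.mem_cons, List.not_mem_nil, or_false, not_or,
        List.nodup_nil, and_true, not_false_eq_true]
      refine ⟨⟨?_, ?_, ?_, ?_, ?_, ?_⟩, ⟨?_, ?_, ?_, ?_, ?_⟩, ⟨?_, ?_, ?_, ?_⟩, ⟨?_, ?_, ?_⟩,
        ⟨?_, ?_⟩, ?_⟩
      all_goals first
        | exact hne (by omega) (by omega) (by omega)
        | exact hqp (by omega)
        | exact hrp (by omega)
        | exact Ne.symm (hqp (by omega))
        | exact Ne.symm hrq
    · obtain ⟨hj1, hj2⟩ := hend hrS hjL har.symm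
      rcases le_total i j with hij | hij
      · exact hG (hp.hasInfinitePlay_of_branches (fun t ht => hqp ht) (fun t ht => hrp ht)
          (Ne.symm hrq) hi1 hij hj2 hiq har)
      · exact hG (hp.hasInfinitePlay_of_branches (fun t ht => hrp ht) (fun t ht => hqp ht)
          hrq hj1 hij hi2 har hiq)
  by_cases hi3 : i ≤ 2
  · exact hp.isContained_of_vertex hG (fun t ht => hqp ht) hcov hi1 hi3 hiL hiq.symm
  by_cases hi4 : L - i ≤ 2
  · refine hp.reverse.isContained_of_vertex hG (fun t _ => hqp (by omega)) (fun v => ?_)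
      (i := L - i) (by omega) hi4 (by omega)
      (by simpa [show L - (L - i) = i by omega] using hiq.symm)
    refine (hcov v).imp_right ?_
    rintro ⟨t, ht, rfl⟩
    exact ⟨L - t, by omega, by rw [show L - (L - t) = t by omega]⟩
  -- Now both arms at p i have length at least three, and with q they contain affine E7.
  exfalso
  obtain ⟨i, rfl⟩ := Nat.exists_eq_add_of_le' (show 3 ≤ i by omega)
  refine hG (hasInfinitePlay_of_arms_one_three_three (b := p (i + 3)) (q := q) (x₁ := p (i + 2))
    (x₂ := p (i + 4)) (y₁ := p (i + 1)) (y₂ := p (i + 5)) (z₁ := p i) (z₂ := p (i + 6)) ?_ hiq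
    (hp.adj (i + 2) (by omega)).symm (hp.adj (i + 3) (by omega)) (hp.adj (i + 1) (by omega)).symm
    (hp.adj (i + 4) (by omega)) (hp.adj i (by omega)).symm (hp.adj (i + 5) (by omega)))
  simp only [List.nodup_cons, List.mem_cons, List.not_mem_nil, or_false, not_or,
    List.nodup_nil, and_true, not_false_eq_true]
  refine ⟨⟨?_, ?_, ?_, ?_, ?_, ?_, ?_⟩, ⟨?_, ?_, ?_, ?_, ?_, ?_⟩, ⟨?_, ?_, ?_, ?_, ?_⟩,
    ⟨?_, ?_, ?_, ?_⟩, ⟨?_, ?_, ?_⟩, ⟨?_, ?_⟩, ?_⟩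
  all_goals first
    | exact hne (by omega) (by omega) (by omega)
    | exact hqp (by omega)
    | exact Ne.symm (hqp (by omega))

end SimpleGraph

namespace CoxeterSystem

variable {B W : Type*} [Group W] {M : CoxeterMatrix B} (cs : CoxeterSystem M W)
variable (h : M.IsSimplyLaced)

/-! ### Factors of reduced expressions of maximally clustered elements -/

/-- The number of letters of `x` joined to `i` in the Coxeter graph. -/
def nbCount (M : CoxeterMatrix B) (i : B) (x : List B) : ℕ := x.countP fun j => M i j = 3

theorem nbCount_append (i : B) (x y : List B) :
    nbCount M i (x ++ y) = nbCount M i x + nbCount M i y := List.countP_append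

theorem nbCount_cons_of_eq {i j : B} (hij : M i j = 3) (x : List B) :
    nbCount M i (j :: x) = nbCount M i x + 1 := by simp [nbCount, hij]

theorem nbCount_eq_zero {i : B} {x : List B} : nbCount M i x = 0 ↔ ∀ j ∈ x, M i j ≠ 3 := by
  simp [nbCount, List.countP_eq_zero]

theorem exists_eq_of_nbCount_pos {i : B} {x : List B} (hx : 0 < nbCount M i x) :
    ∃ x₁ j x₂, x = x₁ ++ j :: x₂ ∧ M i j = 3 := by
  obtain ⟨j, hj, hij⟩ := List.countP_pos_iff.1 hx
  obtain ⟨x₁, x₂, rfl⟩ := List.append_of_mem hj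
  exact ⟨x₁, j, x₂, rfl, by simpa using hij⟩

theorem exists_eq_of_nbCount_eq_one {i : B} {x : List B} (hx : nbCount M i x = 1) :
    ∃ x₁ j x₂, x = x₁ ++ j :: x₂ ∧ M i j = 3 ∧ nbCount M i x₁ = 0 ∧ nbCount M i x₂ = 0 := by
  obtain ⟨x₁, j, x₂, rfl, hij⟩ := exists_eq_of_nbCount_pos (by omega : 0 < nbCount M i x)
  rw [nbCount_append, nbCount_cons_of_eq hij] at hx
  exact ⟨x₁, j, x₂, rfl, hij, by omega, by omega⟩

/-- Two words of the same length and with the same letters have the same product. -/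
structure WordEquiv (ω ω' : List B) : Prop where
  wordProd_eq : cs.wordProd ω = cs.wordProd ω'
  length_eq : ω.length = ω'.length
  mem_iff : ∀ j, j ∈ ω ↔ j ∈ ω'

namespace WordEquiv

variable {cs} {ω₁ ω₂ ω₃ : List B}

theorem refl (ω : List B) : cs.WordEquiv ω ω := ⟨rfl, rfl, fun _ => Iff.rfl⟩

theorem symm (e : cs.WordEquiv ω₁ ω₂) : cs.WordEquiv ω₂ ω₁ :=
  ⟨e.1.symm, e.2.symm, fun j => (e.3 j).symm⟩

theorem trans (e : cs.WordEquiv ω₁ ω₂) (e' : cs.WordEquiv ω₂ ω₃) : cs.WordEquiv ω₁ ω₃ :=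
  ⟨e.1.trans e'.1, e.2.trans e'.2, fun j => (e.3 j).trans (e'.3 j)⟩

theorem append (u v : List B) (e : cs.WordEquiv ω₁ ω₂) :
    cs.WordEquiv (u ++ ω₁ ++ v) (u ++ ω₂ ++ v) :=
  ⟨by simp [wordProd_append, e.1], by simp [e.2], fun j => by simp [e.3 j]⟩

end WordEquiv

theorem wordEquiv_swap (h : M.IsSimplyLaced) {i j : B} (hij : M i j ≠ 3) :
    cs.WordEquiv [i, j] [j, i] := by
  refine ⟨?_, rfl, fun k => by simp [or_comm]⟩
  by_cases hn : i = j
  · rw [hn]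
  · simpa [wordProd_cons] using cs.simple_comm_of_eq_two ((h i j hn).resolve_right hij)

theorem wordEquiv_commute (h : M.IsSimplyLaced) {i : B} {x : List B} (hx : nbCount M i x = 0) :
    cs.WordEquiv (i :: x) (x ++ [i]) := by
  induction x with
  | nil => exact .refl _
  | cons j x ih =>
    rw [nbCount_eq_zero] at hx
    have h1 := (cs.wordEquiv_swap h (hx j (by simp))).append [] x
    have h2 := (ih (nbCount_eq_zero.2 fun k hk => hx k (by simp [hk]))).append [j] []
    simpa using h1.trans (by simpa using h2)

/-- The outer letters i commute inwards past x and y until they meet j. -/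
theorem wordEquiv_short_gap (h : M.IsSimplyLaced) {i j : B} {x y : List B}
    (hx : nbCount M i x = 0) (hy : nbCount M i y = 0) :
    cs.WordEquiv (i :: (x ++ j :: y) ++ [i]) (x ++ [i, j, i] ++ y) := by
  have h1 := (cs.wordEquiv_commute h hx).append [] (j :: y ++ [i])
  have h2 := ((cs.wordEquiv_commute h hy).symm).append (x ++ [i, j]) []
  simpa using h1.trans (by simpa using h2)

theorem wordEquiv_braid {i j : B} (hij : M i j = 3) (x y : List B) :
    cs.WordEquiv (x ++ [i, j, i] ++ y) (x ++ [j, i, j] ++ y) :=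
  ⟨cs.wordProd_braid hij, by simp, fun k => by simp; tauto⟩

theorem wordEquiv_short_gap_braid (h : M.IsSimplyLaced) {i j : B} {x y : List B}
    (hij : M i j = 3) (hx : nbCount M i x = 0) (hy : nbCount M i y = 0) :
    cs.WordEquiv (i :: (x ++ j :: y) ++ [i]) (x ++ [j, i, j] ++ y) :=
  (cs.wordEquiv_short_gap h hx hy).trans (cs.wordEquiv_braid hij x y)

/-- The word `ω` is a factor of a reduced expression of a maximally clustered element. -/
def IsClusterFactor (ω : List B) : Prop :=
  ∃ u v, cs.IsReduced (u ++ ω ++ v) ∧ cs.IsMaximallyClustered h (cs.wordProd (u ++ ω ++ v))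

variable {cs h}

theorem WordEquiv.isReduced {ω ω' : List B} (e : cs.WordEquiv ω ω') (hω : cs.IsReduced ω) :
    cs.IsReduced ω' := by
  rw [IsReduced, ← e.1, ← e.2, hω.eq]

theorem IsClusterFactor.of_equiv {ω ω' : List B} (hω : cs.IsClusterFactor h ω)
    (e : cs.WordEquiv ω ω') : cs.IsClusterFactor h ω' := by
  obtain ⟨u, v, h1, h2⟩ := hω
  have e' := e.append u v
  exact ⟨u, v, e'.isReduced h1, e'.1 ▸ h2⟩

theorem IsClusterFactor.factor {u ω v : List B} (hω : cs.IsClusterFactor h (u ++ ω ++ v)) :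
    cs.IsClusterFactor h ω := by
  obtain ⟨u', v', h1⟩ := hω
  exact ⟨u' ++ u, v ++ v', by simpa using h1⟩

/-- Between two occurrences of a letter there is a letter joined to it. -/
theorem IsClusterFactor.nbCount_pos {i : B} {x : List B}
    (hω : cs.IsClusterFactor h (i :: x ++ [i])) : 0 < nbCount M i x := by
  by_contra h0
  have e := (cs.wordEquiv_commute h (by omega : nbCount M i x = 0)).append [] [i]
  obtain ⟨u, v, hr, -⟩ := hω.of_equiv (by simpa using e)
  exact cs.not_isReduced_pair (u ++ x) v i (by simpa using hr)

theorem simple_mul_wordProd_comm (cs : CoxeterSystem M W) (h : M.IsSimplyLaced) {i : B}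
    {x : List B} (hx : nbCount M i x = 0) :
    cs.simple i * cs.wordProd x = cs.wordProd x * cs.simple i := by
  simpa [wordProd_cons, wordProd_append] using (cs.wordEquiv_commute h hx).1

theorem reflectionRep_inv_wordProd_simpleRoot (cs : CoxeterSystem M W) (h : M.IsSimplyLaced)
    {i : B} {x : List B} (hx : nbCount M i x = 0) (hi : i ∉ x) :
    cs.reflectionRep h (cs.wordProd x)⁻¹ (M.simpleRoot i) = M.simpleRoot i := by
  induction x with
  | nil => simp
  | cons j x ih =>
    rw [nbCount_eq_zero] at hx
    rw [List.mem_cons, not_or] at hi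
    have hm : M j i = 2 := by
      rw [M.symmetric]; exact (h i j hi.1).resolve_right (hx j (by simp))
    rw [wordProd_cons, mul_inv_rev, reflectionRep_mul_apply, inv_simple,
      simple_apply_of_eq_two _ _ hm]
    exact ih (nbCount_eq_zero.2 fun k hk => hx k (by simp [hk])) hi.2

/-- Two adjacent short gaps of the same letter would give rise to intersecting contractible
triples with distinct highest roots. -/
theorem IsClusterFactor.not_two_short_gaps {i : B} {x y : List B}
    (hω : cs.IsClusterFactor h (i :: x ++ i :: y ++ [i])) (hix : i ∉ x) (hiy : i ∉ y)
    (hx : nbCount M i x = 1) (hy : nbCount M i y = 1) : False := by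
  obtain ⟨x₁, j, x₂, rfl, hij, hx₁, hx₂⟩ := exists_eq_of_nbCount_eq_one hx
  obtain ⟨y₁, k, y₂, rfl, hik, hy₁, hy₂⟩ := exists_eq_of_nbCount_eq_one hy
  simp only [List.mem_append, List.mem_cons, not_or] at hix hiy
  obtain ⟨u, v, hr, hmc⟩ := hω
  set w := cs.wordProd (u ++ (i :: (x₁ ++ j :: x₂) ++ i :: (y₁ ++ k :: y₂) ++ [i]) ++ v) with hw
  have r1 : cs.IsReducedExpr
      ((u ++ x₁) ++ [i, j, i] ++ (x₂ ++ (y₁ ++ k :: y₂) ++ [i] ++ v)) w := by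
    have e := (cs.wordEquiv_short_gap h (j := j) hx₁ hx₂).append u ((y₁ ++ k :: y₂) ++ [i] ++ v)
    have e' := e.isReduced (by simpa using hr)
    exact ⟨by simpa using e', by simpa using hw ▸ (by simpa using e.1.symm)⟩
  have r2 : cs.IsReducedExpr
      ((u ++ i :: (x₁ ++ j :: x₂) ++ y₁) ++ [i, k, i] ++ (y₂ ++ v)) w := by
    have e := (cs.wordEquiv_short_gap h (j := k) hy₁ hy₂).append (u ++ i :: (x₁ ++ j :: x₂)) v
    have e' := e.isReduced (by simpa using hr)
    exact ⟨by simpa using e', by simpa using hw ▸ (by simpa using e.1.symm)⟩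
  -- The middle i is the last letter of `iji` and the first of `iki`, so T and T' share its root
  -- (`hcom`). Their highest roots, carried by j and k, must then agree, although they belong to
  -- different positions of one reduced word.
  obtain ⟨T, hT, hTtop, hTi, -⟩ := cs.isContractibleTriple_of_factor h hij r1
  obtain ⟨T', hT', hTtop', -, hTk⟩ := cs.isContractibleTriple_of_factor h hik r2
  have hcom : cs.reflectionRep h
      (cs.wordProd (x₂ ++ (y₁ ++ k :: y₂) ++ [i] ++ v))⁻¹ (M.simpleRoot i) =
      cs.reflectionRep h (cs.wordProd (y₂ ++ v))⁻¹ (M.simpleRoot k) := by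
    have e1 : cs.wordProd (x₂ ++ (y₁ ++ k :: y₂) ++ [i] ++ v) =
        cs.wordProd x₂ * cs.wordProd y₁ * (cs.simple k * cs.simple i) *
          cs.wordProd (y₂ ++ v) := by
      simp only [wordProd_append, wordProd_cons, wordProd_nil, mul_one, mul_assoc]
      rw [← mul_assoc (cs.wordProd y₂) (cs.simple i),
        ← simple_mul_wordProd_comm cs h hy₂, mul_assoc]
    rw [e1]
    simp only [mul_inv_rev, reflectionRep_mul_apply, inv_simple,
      reflectionRep_inv_wordProd_simpleRoot cs h hx₂ hix.2.2,
      reflectionRep_inv_wordProd_simpleRoot cs h hy₁ hiy.1]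
    rw [simple_apply_of_eq_three _ _ (M.symmetric i k ▸ hik), map_add, simple_apply_self,
      simple_apply_of_eq_three _ _ hik]
    simp
  have heq := hmc T T' hT hT' ⟨_, hTi, hcom ▸ hTk⟩ _ _ hTtop hTtop'
  refine cs.root_ne_root h (u := u ++ i :: x₁) (i := j) (x := x₂ ++ i :: y₁) (j := k)
    (v := y₂ ++ [i] ++ v) (by simpa using hr) ?_
  convert heq using 4
  · simp only [wordProd_append, wordProd_cons, wordProd_nil, mul_one, mul_assoc]
    rw [← mul_assoc (cs.simple i) (cs.wordProd x₂), simple_mul_wordProd_comm cs h hx₂, mul_assoc]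
  · simp only [wordProd_append, wordProd_cons, wordProd_nil, mul_one, mul_assoc]
    rw [← mul_assoc (cs.simple i) (cs.wordProd y₂), simple_mul_wordProd_comm cs h hy₂, mul_assoc]

/-- If `i j i` is a short gap, then a gap of `j` on its left has at least three letters joined
to `j`. -/
theorem IsClusterFactor.not_gap_left {i j : B} {p q r : List B} (hij : M i j = 3)
    (hω : cs.IsClusterFactor h (j :: (p ++ i :: q) ++ j :: r ++ [i])) (hjp : j ∉ p) (hjq : j ∉ q)
    (hq : nbCount M i q = 0) (hr : nbCount M i r = 0) : 3 ≤ nbCount M j (p ++ i :: q) := by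
  have hji : M j i = 3 := M.symmetric i j ▸ hij
  -- The braid turns the word into j(pq)jijr. There j has the short gap i, so the adjacent gap pq
  -- has at least two neighbours of j; the letter i taken out of the original gap is a third.
  have e := (cs.wordEquiv_short_gap_braid h hij hq hr).append (j :: p) []
  have h1 := hω.of_equiv (by simpa using e)
  have h2 : cs.IsClusterFactor h (j :: (p ++ q) ++ j :: [i] ++ [j]) :=
    IsClusterFactor.factor (u := []) (v := r) (by simpa using h1)
  have h3 : 0 < nbCount M j (p ++ q) :=
    (IsClusterFactor.factor (u := []) (v := i :: [j]) (by simpa using h2)).nbCount_pos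
  have h4 : nbCount M j (p ++ q) ≠ 1 := fun h5 =>
    h2.not_two_short_gaps (by simp [hjp, hjq]) (by simpa using ne_of_eq_three hji) h5
      (nbCount_cons_of_eq hji [])
  rw [nbCount_append] at h3 h4 ⊢
  rw [nbCount_cons_of_eq hji]
  omega

/-- If `i j i` is a short gap, then a gap of `j` on its right has at least three letters joined
to `j`. -/
theorem IsClusterFactor.not_gap_right {i j : B} {p q r : List B} (hij : M i j = 3)
    (hω : cs.IsClusterFactor h (i :: r ++ j :: (q ++ i :: p) ++ [j])) (hjp : j ∉ p) (hjq : j ∉ q)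
    (hq : nbCount M i q = 0) (hr : nbCount M i r = 0) : 3 ≤ nbCount M j (q ++ i :: p) := by
  have hji : M j i = 3 := M.symmetric i j ▸ hij
  have e := (cs.wordEquiv_short_gap_braid h hij hr hq).append [] (p ++ [j])
  have h1 := hω.of_equiv (by simpa using e)
  have h2 : cs.IsClusterFactor h (j :: [i] ++ j :: (q ++ p) ++ [j]) :=
    IsClusterFactor.factor (u := r) (v := []) (by simpa using h1)
  have h3 : 0 < nbCount M j (q ++ p) :=
    (IsClusterFactor.factor (u := j :: [i]) (v := []) (by simpa using h2)).nbCount_pos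
  have h4 : nbCount M j (q ++ p) ≠ 1 := fun h5 =>
    h2.not_two_short_gaps (by simpa using ne_of_eq_three hji) (by simp [hjp, hjq])
      (nbCount_cons_of_eq hji []) h5
  rw [nbCount_append] at h3 h4 ⊢
  rw [nbCount_cons_of_eq hji]
  omega

end CoxeterSystem

/-! ### Splitting lists at letters with a given property -/

namespace List

variable {α : Type*} {P : α → Bool}

theorem exists_first_of_countP_pos {x : List α} (hx : 0 < x.countP P) :
    ∃ y a z, x = y ++ a :: z ∧ P a ∧ y.countP P = 0 := by
  induction x with
  | nil => simp at hx
  | cons b x ih =>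
    by_cases hb : P b
    · exact ⟨[], b, x, rfl, hb, rfl⟩
    · obtain ⟨y, a, z, rfl, ha, hy⟩ := ih (by simpa [hb] using hx)
      exact ⟨b :: y, a, z, rfl, ha, by simpa [hb] using hy⟩

theorem exists_last_of_countP_pos {x : List α} (hx : 0 < x.countP P) :
    ∃ y a z, x = y ++ a :: z ∧ P a ∧ z.countP P = 0 := by
  obtain ⟨y, a, z, hyz, ha, hy⟩ := exists_first_of_countP_pos (x := x.reverse) (P := P)
    (by rwa [countP_reverse])
  refine ⟨z.reverse, a, y.reverse, ?_, ha, by rwa [countP_reverse]⟩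
  rw [← reverse_reverse x, hyz]
  simp

theorem exists_two_of_countP {x : List α} (hx : 2 ≤ x.countP P) :
    ∃ x₁ a x₂ b x₃, x = x₁ ++ a :: x₂ ++ b :: x₃ ∧ P a ∧ P b ∧ x₁.countP P = 0 ∧
      x₂.countP P = 0 := by
  obtain ⟨y, a, z, rfl, ha, hy⟩ := exists_first_of_countP_pos (by omega : 0 < x.countP P)
  rw [countP_append, countP_cons_of_pos ha] at hx
  obtain ⟨y', b, z', rfl, hb, hy'⟩ := exists_first_of_countP_pos (by omega : 0 < z.countP P)
  exact ⟨y, a, y', b, z', by simp, ha, hb, hy, hy'⟩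

end List

namespace CoxeterSystem

variable {B W : Type*} [Group W] {M : CoxeterMatrix B} {cs : CoxeterSystem M W}
variable {h : M.IsSimplyLaced}

/-! ### Labellings by the vertices of a graph of type `E` -/

/-- The neighbour of the vertex `k ≠ 3` that is closer to the branch vertex `3`. -/
def parentE (k : ℕ) : ℕ := if k ≤ 2 then if k = 1 then 2 else 3 else k - 1

/-- The distance of the vertex `k` from the branch vertex `3`. -/
def depthE (k : ℕ) : ℕ := if k = 0 then 1 else if k ≤ 3 then 3 - k else k - 3

/-- The map `φ` embeds the subgraph of the Coxeter graph on `C` into a graph of type `E`. -/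
structure IsLabelling (M : CoxeterMatrix B) (C : Set B) (φ : B → ℕ) : Prop where
  inj : ∀ i ∈ C, ∀ j ∈ C, φ i = φ j → i = j
  adj : ∀ i ∈ C, ∀ j ∈ C, M i j = 3 →
    φ i ≠ 3 ∧ parentE (φ i) = φ j ∨ φ j ≠ 3 ∧ parentE (φ j) = φ i

/-- The number of letters of `x` with the label `k`. -/
def labCount (φ : B → ℕ) (k : ℕ) (x : List B) : ℕ := x.countP fun j => φ j = k

section labCount

variable {φ : B → ℕ}

theorem labCount_nil (k : ℕ) : labCount φ k [] = 0 := rfl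

theorem labCount_append (k : ℕ) (x y : List B) :
    labCount φ k (x ++ y) = labCount φ k x + labCount φ k y := List.countP_append

theorem labCount_cons_of_eq {k : ℕ} {j : B} (hj : φ j = k) (x : List B) :
    labCount φ k (j :: x) = labCount φ k x + 1 := by simp [labCount, hj]

theorem labCount_cons_of_ne {k : ℕ} {j : B} (hj : φ j ≠ k) (x : List B) :
    labCount φ k (j :: x) = labCount φ k x := by simp [labCount, hj]

theorem labCount_eq_zero {k : ℕ} {x : List B} : labCount φ k x = 0 ↔ ∀ j ∈ x, φ j ≠ k := by
  simp [labCount, List.countP_eq_zero]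

theorem labCount_pos {k : ℕ} {x : List B} : 0 < labCount φ k x ↔ ∃ j ∈ x, φ j = k := by
  simp [labCount, List.countP_pos_iff]

/-- This bounds the number of neighbours of a letter by the multiplicities of the few labels that
they can have. -/
theorem countP_le_sum_labCount {P : B → Bool} (l : List ℕ) (x : List B)
    (hx : ∀ j ∈ x, P j → φ j ∈ l) : x.countP P ≤ (l.map fun k => labCount φ k x).sum := by
  induction x with
  | nil => simp
  | cons j x ih =>
    have h1 := ih fun k hk => hx k (by simp [hk])
    have h2 : (l.map fun k => labCount φ k (j :: x)).sum =
        (l.map fun k => labCount φ k x).sum + l.count (φ j) := by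
      clear hx ih h1
      induction l with
      | nil => rfl
      | cons k l ih =>
        rw [List.map_cons, List.sum_cons, ih, List.map_cons, List.sum_cons]
        by_cases hk : φ j = k
        · rw [labCount_cons_of_eq hk, hk, List.count_cons_self]; omega
        · rw [labCount_cons_of_ne hk, List.count_cons_of_ne (Ne.symm hk)]; omega
    rw [h2]
    by_cases hj : P j
    · rw [List.countP_cons_of_pos hj]
      have := List.count_pos_iff.2 (hx j (by simp) hj)
      omega
    · rw [List.countP_cons_of_neg hj]
      omega

theorem nbCount_le_sum_labCount {i : B} (l : List ℕ) (x : List B)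
    (hx : ∀ j ∈ x, M i j = 3 → φ j ∈ l) : nbCount M i x ≤ (l.map fun k => labCount φ k x).sum :=
  countP_le_sum_labCount l x fun j hj hij => hx j hj (by simpa using hij)

end labCount

/-! ### Normal factors and the gaps of the branch vertex -/

variable (cs h) in
/-- A factor of a reduced expression of a maximally clustered element, with letters in `C`, whose
letters are as far from the branch vertex as possible. -/
structure IsNormalFactor (C : Set B) (φ : B → ℕ) (ω : List B) : Prop where
  isClusterFactor : cs.IsClusterFactor h ω
  mem : ∀ i ∈ ω, i ∈ C
  max : ∀ ω', cs.WordEquiv ω ω' →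
    (ω'.map fun i => depthE (φ i)).sum ≤ (ω.map fun i => depthE (φ i)).sum

namespace IsNormalFactor

variable {C : Set B} {φ : B → ℕ}

/-- An equivalence of the factor extends to the whole word, and the sum of depths is additive. -/
theorem factor {u ω v : List B} (hω : cs.IsNormalFactor h C φ (u ++ ω ++ v)) :
    cs.IsNormalFactor h C φ ω where
  isClusterFactor := hω.isClusterFactor.factor
  mem i hi := hω.mem i (by simp [hi])
  max ω' e := by
    have := hω.max _ (e.append u v)
    simp only [List.map_append, List.sum_append] at this
    omega

/-- The letter in the middle of a short gap is closer to the branch vertex. -/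
theorem depthE_le {i j : B} {x y : List B}
    (hω : cs.IsNormalFactor h C φ (i :: (x ++ j :: y) ++ [i])) (hij : M i j = 3)
    (hx : nbCount M i (x ++ j :: y) = 1) : depthE (φ j) ≤ depthE (φ i) := by
  rw [nbCount_append, nbCount_cons_of_eq hij] at hx
  -- Replacing `iji` by `jij` changes the sum of depths by the depth of j minus that of i.
  have := hω.max _ (cs.wordEquiv_short_gap_braid h hij (by omega) (by omega))
  simp only [List.map_append, List.map_cons, List.map_nil, List.sum_append, List.sum_cons,
    List.sum_nil] at this
  omega

/-- A single neighbour would be the middle of a short gap and deeper than the branch vertex. -/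
theorem two_le_nbCount (hφ : IsLabelling M C φ) {b : B} {x : List B}
    (hω : cs.IsNormalFactor h C φ (b :: x ++ [b])) (hb : φ b = 3) : 2 ≤ nbCount M b x := by
  have h0 := hω.isClusterFactor.nbCount_pos
  by_contra h2
  obtain ⟨x₁, j, x₂, rfl, hj⟩ := exists_eq_of_nbCount_pos h0
  have h1 := hω.depthE_le hj (by omega)
  have h3 := hφ.adj b (hω.mem b (by simp)) j (hω.mem j (by simp)) hj
  rw [hb] at h1 h3
  rcases h3 with h3 | h3
  · exact h3.1 rfl
  · unfold depthE at h1
    split_ifs at h1 <;> omega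

/-- Between two occurrences of a letter other than the branch vertex there is a neighbour that is
closer to the branch vertex. -/
theorem exists_parent (hφ : IsLabelling M C φ) {i : B} {x : List B}
    (hω : cs.IsNormalFactor h C φ (i :: x ++ [i])) (hix : i ∉ x) (hi : φ i ≠ 3) :
    ∃ j ∈ x, φ j = parentE (φ i) := by
  induction hn : x.length using Nat.strong_induction_on generalizing x i with
  | _ n ih =>
  subst hn
  by_contra hno
  push Not at hno
  have hiC := hω.mem i (by simp)
  have hxC : ∀ j ∈ x, j ∈ C := fun j hj => hω.mem j (by simp [hj])
  have hchild : ∀ j ∈ x, M i j = 3 → φ j ≠ 3 ∧ parentE (φ j) = φ i := fun j hj hij =>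
    (hφ.adj i hiC j (hxC j hj) hij).resolve_left fun hh => hno j hj hh.2.symm
  obtain ⟨x₁, j, x₂, hx, hj⟩ := exists_eq_of_nbCount_pos hω.isClusterFactor.nbCount_pos
  have hjx : j ∈ x := by simp [hx]
  obtain ⟨hj3, hjp⟩ := hchild j hjx hj
  by_cases h1 : nbCount M i x = 1
  · subst hx
    have := hω.depthE_le hj h1
    rw [← hjp] at this hi
    unfold depthE parentE at this
    unfold parentE at hi
    split_ifs at this hi <;> omega
  · have h2 : 2 ≤ labCount φ (φ j) x := by
      have h0 := hω.isClusterFactor.nbCount_pos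
      have := nbCount_le_sum_labCount (M := M) (φ := φ) (i := i) [φ j] x fun k hk hik => by
        obtain ⟨hk3, hkp⟩ := hchild k hk hik
        rw [List.mem_singleton]
        rw [← hjp] at hkp hi
        unfold parentE at hkp hi
        split_ifs at hkp hi <;> omega
      simp at this
      omega
    obtain ⟨y₁, a, y₂, b, y₃, rfl, ha, hb, -, hy₂⟩ := List.exists_two_of_countP h2
    simp only [decide_eq_true_eq] at ha hb
    obtain rfl : a = j := hφ.inj a (hxC a (by simp)) j (hxC j hjx) ha
    obtain rfl : b = a := hφ.inj b (hxC b (by simp)) a (hxC a hjx) hb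
    obtain ⟨c, hc, hcp⟩ := ih y₂.length (by simp; omega) (i := b) (x := y₂)
      (IsNormalFactor.factor (u := i :: y₁) (v := y₃ ++ [i]) (by simpa using hω))
      (fun hmem => labCount_eq_zero.1 hy₂ b hmem rfl) hj3 rfl
    rw [hjp] at hcp
    obtain rfl := hφ.inj c (hxC c (by simp [hc])) i hiC hcp
    exact hix (by simp [hc])

/-- Each gap between consecutive letters of label k contains a letter of the parent label. -/
theorem labCount_le_parent (hφ : IsLabelling M C φ) {ω : List B}
    (hω : cs.IsNormalFactor h C φ ω) {k : ℕ} (hk : k ≠ 3) :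
    labCount φ k ω ≤ labCount φ (parentE k) ω + 1 := by
  induction hn : ω.length using Nat.strong_induction_on generalizing ω with
  | _ n ih =>
  subst hn
  by_contra hcon
  obtain ⟨x₁, a, x₂, b, x₃, rfl, ha, hb, hx₁, hx₂⟩ :=
    List.exists_two_of_countP (by omega : 2 ≤ labCount φ k ω)
  simp only [decide_eq_true_eq] at ha hb
  obtain rfl : a = b := hφ.inj a (hω.mem a (by simp)) b (hω.mem b (by simp)) (ha.trans hb.symm)
  change labCount φ k x₁ = 0 at hx₁
  change labCount φ k x₂ = 0 at hx₂
  have hpos : 0 < labCount φ (parentE k) x₂ := by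
    rw [labCount_pos, ← ha]
    exact exists_parent hφ (i := a)
      (IsNormalFactor.factor (u := x₁) (v := x₃) (by simpa using hω))
      (fun hmem => labCount_eq_zero.1 hx₂ a hmem ha) (ha ▸ hk)
  have h1 := ih (a :: x₃).length (by simp; omega)
    (IsNormalFactor.factor (u := x₁ ++ a :: x₂) (v := []) (by simpa using hω)) rfl
  simp only [labCount_append, labCount_cons_of_eq ha, hx₁, hx₂] at hcon h1
  have h2 : labCount φ (parentE k) x₃ ≤ labCount φ (parentE k) (a :: x₃) :=
    (List.sublist_cons_self a x₃).countP_le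
  have h3 : labCount φ (parentE k) x₂ ≤ labCount φ (parentE k) (a :: x₂) :=
    (List.sublist_cons_self a x₂).countP_le
  omega

theorem label_of_adj_three (hφ : IsLabelling M C φ) {b j : B} (hb : b ∈ C) (hj : j ∈ C)
    (hb3 : φ b = 3) (hbj : M b j = 3) : φ j ∈ [0, 2, 4] := by
  have := hφ.adj b hb j hj hbj
  rw [hb3] at this
  rcases this with hh | ⟨h1, h2⟩
  · exact absurd rfl hh.1
  · unfold parentE at h2
    simp only [List.mem_cons, List.not_mem_nil, or_false]
    split_ifs at h2 <;> omega

theorem label_of_adj_zero (hφ : IsLabelling M C φ) {i j : B} (hi : i ∈ C) (hj : j ∈ C)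
    (hi0 : φ i = 0) (hij : M i j = 3) : φ j = 3 := by
  have := hφ.adj i hi j hj hij
  rw [hi0] at this
  rcases this with ⟨-, h1⟩ | ⟨-, h1⟩
  · exact h1.symm
  · unfold parentE at h1
    split_ifs at h1
    omega

theorem label_of_adj_one (hφ : IsLabelling M C φ) {i j : B} (hi : i ∈ C) (hj : j ∈ C)
    (hi1 : φ i = 1) (hij : M i j = 3) : φ j = 2 := by
  have := hφ.adj i hi j hj hij
  rw [hi1] at this
  unfold parentE at this
  split_ifs at this <;> omega

theorem label_of_adj_two (hφ : IsLabelling M C φ) {i j : B} (hi : i ∈ C) (hj : j ∈ C)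
    (hi2 : φ i = 2) (hij : M i j = 3) : φ j ∈ [1, 3] := by
  have := hφ.adj i hi j hj hij
  rw [hi2] at this
  unfold parentE at this
  simp only [List.mem_cons, List.not_mem_nil, or_false]
  split_ifs at this <;> omega

theorem label_of_adj_of_four_le (hφ : IsLabelling M C φ) {i j : B} (hi : i ∈ C) (hj : j ∈ C)
    {k : ℕ} (hk : 3 ≤ k) (hik : φ i = k + 1) (hij : M i j = 3) : φ j ∈ [k, k + 2] := by
  have := hφ.adj i hi j hj hij
  rw [hik] at this
  unfold parentE at this
  simp only [List.mem_cons, List.not_mem_nil, or_false]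
  split_ifs at this <;> omega

/-- Away from the ends of the word, any two consecutive occurrences of the branch vertex have the
vertex `4` between them. -/
theorem exists_label_four (hφ : IsLabelling M C φ) {b : B} {y₁ x y₂ : List B}
    (hω : cs.IsNormalFactor h C φ (b :: y₁ ++ b :: x ++ b :: y₂ ++ [b])) (hb : φ b = 3)
    (hy₁ : labCount φ 3 y₁ = 0) (hx : labCount φ 3 x = 0) (hy₂ : labCount φ 3 y₂ = 0) :
    ∃ j ∈ x, φ j = 4 := by
  by_contra hno
  push Not at hno
  have hbC : b ∈ C := hω.mem b (by simp)
  have hxC : ∀ j ∈ x, j ∈ C := fun j hj => hω.mem j (by simp [hj])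
  have hy₁C : ∀ j ∈ y₁, j ∈ C := fun j hj => hω.mem j (by simp [hj])
  have hy₂C : ∀ j ∈ y₂, j ∈ C := fun j hj => hω.mem j (by simp [hj])
  have hbx : ∀ {z}, labCount φ 3 z = 0 → b ∉ z := fun hz hmem => labCount_eq_zero.1 hz b hmem hb
  have nx : cs.IsNormalFactor h C φ x := factor (u := b :: y₁ ++ [b]) (v := b :: y₂ ++ [b])
    (by simpa using hω)
  have ny₁ : cs.IsNormalFactor h C φ y₁ := factor (u := [b]) (v := b :: x ++ b :: y₂ ++ [b])
    (by simpa using hω)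
  have ny₂ : cs.IsNormalFactor h C φ y₂ := factor (u := b :: y₁ ++ b :: x ++ [b]) (v := [b])
    (by simpa using hω)
  have nbx : cs.IsNormalFactor h C φ (b :: x ++ [b]) :=
    factor (u := b :: y₁) (v := y₂ ++ [b]) (by simpa using hω)
  have nby₁ : cs.IsNormalFactor h C φ (b :: y₁ ++ [b]) :=
    factor (u := []) (v := x ++ b :: y₂ ++ [b]) (by simpa using hω)
  have nby₂ : cs.IsNormalFactor h C φ (b :: y₂ ++ [b]) :=
    factor (u := b :: y₁ ++ b :: x) (v := []) (by simpa using hω)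
  have le_one : ∀ {z}, cs.IsNormalFactor h C φ z → labCount φ 3 z = 0 →
      labCount φ 0 z ≤ 1 ∧ labCount φ 2 z ≤ 1 ∧ labCount φ 4 z ≤ 1 := by
    intro z hz hz3
    have h0 := hz.labCount_le_parent hφ (k := 0) (by omega)
    have h2 := hz.labCount_le_parent hφ (k := 2) (by omega)
    have h4 := hz.labCount_le_parent hφ (k := 4) (by omega)
    simp only [parentE] at h0 h2 h4
    norm_num at h0 h2 h4
    omega
  have nb_le : ∀ {z}, (∀ j ∈ z, j ∈ C) →
      nbCount M b z ≤ labCount φ 0 z + labCount φ 2 z + labCount φ 4 z := by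
    intro z hz
    have := nbCount_le_sum_labCount (M := M) (φ := φ) (i := b) [0, 2, 4] z fun j hj hbj =>
      label_of_adj_three hφ hbC (hz j hj) hb hbj
    simp at this
    omega
  have hx4 : labCount φ 4 x = 0 := labCount_eq_zero.2 hno
  have hx2 := nbx.two_le_nbCount hφ hb
  have hxle := nb_le hxC
  obtain ⟨hx0, hx2', -⟩ := le_one nx hx
  -- The gap x needs two neighbours of b. Without the label 4 only 0 and 2 are left, each at most
  -- once, so both occur.
  have hcenter : ∀ k k', (k = 0 ∧ k' = 2 ∨ k = 2 ∧ k' = 0) → ∃ j ∈ x, M b j = 3 ∧ φ j = k := by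
    intro k k' hkk
    by_contra hcon
    push Not at hcon
    have := nbCount_le_sum_labCount (M := M) (φ := φ) (i := b) [k'] x fun j hj hbj => by
      have h1 := label_of_adj_three hφ hbC (hxC j hj) hb hbj
      have h2 := hcon j hj hbj
      have h3 := hno j hj
      simp only [List.mem_cons, List.not_mem_nil, or_false] at h1 ⊢
      omega
    simp at this
    rcases hkk with ⟨rfl, rfl⟩ | ⟨rfl, rfl⟩ <;> omega
  -- the vertex `0` occurs neither in `y₁` nor in `y₂`
  have hy0 : labCount φ 0 y₁ = 0 ∧ labCount φ 0 y₂ = 0 := by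
    obtain ⟨i, hix, hbi, hi⟩ := hcenter 0 2 (.inl ⟨rfl, rfl⟩)
    have hib : M i b = 3 := M.symmetric b i ▸ hbi
    have hiC := hxC i hix
    obtain ⟨p, q, rfl⟩ := List.append_of_mem hix
    simp only [labCount_append, labCount_cons_of_ne (show φ i ≠ 3 by omega)] at hx
    have nb0 : ∀ {z}, (∀ j ∈ z, j ∈ C) → labCount φ 3 z = 0 → nbCount M i z = 0 :=
      fun hzC hz => nbCount_eq_zero.2 fun j hj hij =>
        labCount_eq_zero.1 hz j hj (label_of_adj_zero hφ hiC (hzC j hj) hi hij)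
    constructor <;> by_contra hpos
    · obtain ⟨j, hj, hj0⟩ := labCount_pos.1 (Nat.pos_of_ne_zero hpos)
      obtain rfl := hφ.inj j (hy₁C j hj) i hiC (hj0.trans hi.symm)
      obtain ⟨s, r, rfl⟩ := List.append_of_mem hj
      simp only [labCount_append, labCount_cons_of_ne (show φ j ≠ 3 by omega)] at hy₁
      -- From its occurrence in y₁ to that in x the vertex 0 has a short gap with middle b. This
      -- would require three neighbours of b in x, which has at most two.
      have := IsClusterFactor.not_gap_right (p := q) (q := p) (r := r) hib
        (IsClusterFactor.factor (u := b :: s) (v := y₂ ++ [b])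
          (by simpa using hω.isClusterFactor)) (hbx (by omega)) (hbx (by omega))
        (nb0 (fun k hk => hxC k (by simp [hk])) (by omega))
        (nb0 (fun k hk => hy₁C k (by simp [hk])) (by omega))
      omega
    · obtain ⟨j, hj, hj0⟩ := labCount_pos.1 (Nat.pos_of_ne_zero hpos)
      obtain rfl := hφ.inj j (hy₂C j hj) i hiC (hj0.trans hi.symm)
      obtain ⟨r, s, rfl⟩ := List.append_of_mem hj
      simp only [labCount_append, labCount_cons_of_ne (show φ j ≠ 3 by omega)] at hy₂
      have := IsClusterFactor.not_gap_left (p := p) (q := q) (r := r) hib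
        (IsClusterFactor.factor (u := b :: y₁) (v := s ++ [b])
          (by simpa using hω.isClusterFactor)) (hbx (by omega)) (hbx (by omega))
        (nb0 (fun k hk => hxC k (by simp [hk])) (by omega))
        (nb0 (fun k hk => hy₂C k (by simp [hk])) (by omega))
      omega
  -- so the vertex `2` occurs in all three gaps
  obtain ⟨i, hix, hbi, hi⟩ := hcenter 2 0 (.inr ⟨rfl, rfl⟩)
  have hib : M i b = 3 := M.symmetric b i ▸ hbi
  have hiC := hxC i hix
  have hmem : ∀ {z}, (∀ j ∈ z, j ∈ C) → cs.IsNormalFactor h C φ z →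
      cs.IsNormalFactor h C φ (b :: z ++ [b]) → labCount φ 3 z = 0 → labCount φ 0 z = 0 →
      i ∈ z := by
    intro z hzC hz hbz hz3 hz0
    have h1 := hbz.two_le_nbCount hφ hb
    have h2 := nb_le hzC
    obtain ⟨-, -, h3⟩ := le_one hz hz3
    obtain ⟨j, hj, hj2⟩ := labCount_pos.1 (show 0 < labCount φ 2 z by omega)
    obtain rfl := hφ.inj j (hzC j hj) i hiC (hj2.trans hi.symm)
    exact hj
  have hi₁ := hmem hy₁C ny₁ nby₁ hy₁ hy0.1
  have hi₂ := hmem hy₂C ny₂ nby₂ hy₂ hy0.2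
  have hy₁2 := (le_one ny₁ hy₁).2.1
  have hy₂2 := (le_one ny₂ hy₂).2.1
  obtain ⟨xl, xr, rfl⟩ := List.append_of_mem hix
  obtain ⟨s₁, r₁, rfl⟩ := List.append_of_mem hi₁
  obtain ⟨r₂, s₂, rfl⟩ := List.append_of_mem hi₂
  have hi3 : φ i ≠ 3 := by omega
  simp only [labCount_append, labCount_cons_of_ne hi3, labCount_cons_of_eq hi] at *
  -- the vertex `1` occurs on both sides of the middle occurrence of the vertex `2`
  have hone : ∀ {z}, (∀ j ∈ z, j ∈ C) → labCount φ 3 z = 0 → nbCount M i z ≠ 0 →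
      ∃ j ∈ z, M i j = 3 ∧ φ j = 1 := by
    intro z hzC hz hne
    obtain ⟨z₁, j, z₂, rfl, hij⟩ := exists_eq_of_nbCount_pos (Nat.pos_of_ne_zero hne)
    refine ⟨j, by simp, hij, ?_⟩
    have h1 := label_of_adj_two hφ hiC (hzC j (by simp)) hi hij
    have h2 := labCount_eq_zero.1 hz j (by simp)
    simp only [List.mem_cons, List.not_mem_nil, or_false] at h1
    omega
  have hC1 : ∀ j ∈ r₁ ++ xl, j ∈ C := fun j hj => by
    rcases List.mem_append.1 hj with hj | hj
    · exact hy₁C j (by simp [hj])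
    · exact hxC j (by simp [hj])
  have hC2 : ∀ j ∈ xr ++ r₂, j ∈ C := fun j hj => by
    rcases List.mem_append.1 hj with hj | hj
    · exact hxC j (by simp [hj])
    · exact hy₂C j (by simp [hj])
  obtain ⟨e, he, hie, he1⟩ := hone hC1 (by rw [labCount_append]; omega) (by
    intro h0
    rw [nbCount_append] at h0
    have := IsClusterFactor.not_gap_right (p := xr) (q := xl) (r := r₁) hib
      (IsClusterFactor.factor (u := b :: s₁) (v := r₂ ++ i :: s₂ ++ [b])
        (by simpa using hω.isClusterFactor)) (hbx (by omega)) (hbx (by omega))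
      (by omega) (by omega)
    omega)
  obtain ⟨e', he', -, he1'⟩ := hone hC2 (by rw [labCount_append]; omega) (by
    intro h0
    rw [nbCount_append] at h0
    have := IsClusterFactor.not_gap_left (p := xl) (q := xr) (r := r₂) hib
      (IsClusterFactor.factor (u := b :: s₁ ++ i :: r₁) (v := s₂ ++ [b])
        (by simpa using hω.isClusterFactor)) (hbx (by omega)) (hbx (by omega))
      (by omega) (by omega)
    omega)
  obtain rfl := hφ.inj e' (hC2 e' he') e (hC1 e he) (he1'.trans he1.symm)
  have heC := hC1 e' he
  have hb2 : φ b ≠ 2 := by omega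
  have heα : e' ∈ r₁ ++ b :: xl := by
    rcases List.mem_append.1 he with hh | hh <;> simp [hh]
  have heβ : e' ∈ xr ++ b :: r₂ := by
    rcases List.mem_append.1 he' with hh | hh <;> simp [hh]
  have hCα : ∀ j ∈ r₁ ++ b :: xl, j ∈ C := fun j hj => hω.mem j (by
    simp only [List.mem_append, List.mem_cons] at hj ⊢; tauto)
  have hCβ : ∀ j ∈ xr ++ b :: r₂, j ∈ C := fun j hj => hω.mem j (by
    simp only [List.mem_append, List.mem_cons] at hj ⊢; tauto)
  have hα2 : labCount φ 2 (r₁ ++ b :: xl) = 0 := by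
    rw [labCount_append, labCount_cons_of_ne hb2]; omega
  have hβ2 : labCount φ 2 (xr ++ b :: r₂) = 0 := by
    rw [labCount_append, labCount_cons_of_ne hb2]; omega
  have nα : cs.IsNormalFactor h C φ (r₁ ++ b :: xl) :=
    factor (u := b :: s₁ ++ [i]) (v := i :: xr ++ b :: (r₂ ++ i :: s₂) ++ [b])
      (by simpa using hω)
  have hα1 : labCount φ 1 (r₁ ++ b :: xl) ≤ 1 := by
    have := nα.labCount_le_parent hφ (k := 1) (by omega)
    simp only [parentE] at this
    norm_num at this
    omega
  have hα3 : labCount φ 3 (r₁ ++ b :: xl) = 1 := by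
    rw [labCount_append, labCount_cons_of_eq hb]; omega
  have hnb : nbCount M i (r₁ ++ b :: xl) ≤ 2 := by
    have := nbCount_le_sum_labCount (M := M) (φ := φ) (i := i) [1, 3] (r₁ ++ b :: xl)
      fun j hj hij => label_of_adj_two hφ hiC (hCα j hj) hi hij
    simp at this
    omega
  have hiα : i ∉ r₁ ++ b :: xl := fun hh => labCount_eq_zero.1 hα2 i hh hi
  have nb1 : ∀ j ∈ C, j ∈ r₁ ++ b :: xl ∨ j ∈ xr ++ b :: r₂ → M e' j ≠ 3 := fun j hjC hj hej =>
    hj.elim (fun hj => labCount_eq_zero.1 hα2 j hj (label_of_adj_one hφ heC hjC he1 hej))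
      fun hj => labCount_eq_zero.1 hβ2 j hj (label_of_adj_one hφ heC hjC he1 hej)
  -- Between these two occurrences of the vertex 1 its only neighbour is the middle occurrence of
  -- the vertex 2, so the gap is short. The gap of the vertex 2 to the left of that occurrence would
  -- then need three neighbours, but it contains the labels 1 and 3 at most once each.
  obtain ⟨α₁, α₂, hα⟩ := List.append_of_mem heα
  obtain ⟨β₁, β₂, hβ⟩ := List.append_of_mem heβ
  rw [hα] at hiα hnb
  have := IsClusterFactor.not_gap_left (i := e') (j := i) (p := α₁) (q := α₂) (r := β₁)
    (cs := cs) (h := h) (M.symmetric i e' ▸ hie) ?_ (fun hh => hiα (by simp [hh]))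
    (fun hh => hiα (by simp [hh]))
    (nbCount_eq_zero.2 fun j hj => nb1 j (hCα j (by simp [hα, hj])) (.inl (by simp [hα, hj])))
    (nbCount_eq_zero.2 fun j hj => nb1 j (hCβ j (by simp [hβ, hj])) (.inr (by simp [hβ, hj])))
  · omega
  · refine IsClusterFactor.factor (u := b :: s₁) (v := β₂ ++ i :: s₂ ++ [b]) ?_
    have e1 : b :: s₁ ++ (i :: (α₁ ++ e' :: α₂) ++ i :: β₁ ++ [e']) ++ (β₂ ++ i :: s₂ ++ [b]) =
        b :: s₁ ++ i :: (α₁ ++ e' :: α₂) ++ i :: (β₁ ++ e' :: β₂) ++ i :: s₂ ++ [b] := by simp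
    rw [e1, ← hα, ← hβ]
    simpa using hω.isClusterFactor

end IsNormalFactor

end CoxeterSystem

/-! ### The long arm and the length of normal factors -/

namespace CoxeterSystem

variable {B W : Type*} [Group W] {M : CoxeterMatrix B} {cs : CoxeterSystem M W}
variable {h : M.IsSimplyLaced}

namespace IsNormalFactor

variable {C : Set B} {φ : B → ℕ}

/-- Away from the ends of the word, a gap of a vertex on the long arm that does not contain the
next vertex on the arm can be made short. -/
theorem exists_short_gap (hφ : IsLabelling M C φ) {k : ℕ} (hk : 3 ≤ k) {u x v : List B} {i : B}
    (hω : cs.IsNormalFactor h C φ (u ++ i :: x ++ i :: v)) (hi : φ i = k + 1)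
    (hu : 0 < labCount φ 3 u) (hv : 0 < labCount φ 3 v) (hx : labCount φ (k + 1) x = 0)
    (hx' : labCount φ (k + 2) x = 0) : ∃ x', cs.WordEquiv x x' ∧ nbCount M i x' = 1 := by
  induction k, hk using Nat.le_induction generalizing u x v i with
  | base =>
    have hiC : i ∈ C := hω.mem i (by simp)
    have h1 : cs.IsClusterFactor h (i :: x ++ [i]) :=
      IsClusterFactor.factor (u := u) (v := v) (by simpa using hω.isClusterFactor)
    have h2 := h1.nbCount_pos
    have h3 := nbCount_le_sum_labCount (M := M) (φ := φ) (i := i) [3, 3 + 2] x fun j hj hij =>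
      label_of_adj_of_four_le hφ hiC (hω.mem j (by simp [hj])) le_rfl hi hij
    simp only [List.map_cons, List.map_nil, List.sum_cons, List.sum_nil, hx'] at h3
    by_cases h4 : labCount φ 3 x ≤ 1
    · exact ⟨x, .refl x, by omega⟩
    -- Two consecutive branch vertices in x, together with the nearest ones on either side, would
    -- force a letter of label 4 into x.
    exfalso
    obtain ⟨x₁, b, x₂, b', x₃, rfl, hb, hb', -, hx₂⟩ :=
      List.exists_two_of_countP (by omega : 2 ≤ labCount φ 3 x)
    simp only [decide_eq_true_eq] at hb hb'
    have heq : ∀ c ∈ u ++ i :: (x₁ ++ b :: x₂ ++ b' :: x₃) ++ i :: v, φ c = 3 → c = b :=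
      fun c hc hc3 => hφ.inj c (hω.mem c hc) b (hω.mem b (by simp)) (hc3.trans hb.symm)
    obtain rfl := heq b' (by simp) hb'
    obtain ⟨u₁, c, y₁, hu₁, hc, hy₁⟩ := List.exists_last_of_countP_pos
      (P := fun j => φ j = 3) (x := u ++ i :: x₁) (by
        change 0 < labCount φ 3 _; rw [labCount_append]; omega)
    obtain ⟨y₂, d, v₂, hv₂, hd, hy₂⟩ := List.exists_first_of_countP_pos
      (P := fun j => φ j = 3) (x := x₃ ++ i :: v) (by
        change 0 < labCount φ 3 _
        rw [labCount_append, labCount_cons_of_ne (by omega)]; omega)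
    simp only [decide_eq_true_eq] at hc hd
    have hwhole : u ++ i :: (x₁ ++ b' :: x₂ ++ b' :: x₃) ++ i :: v =
        u₁ ++ (c :: y₁ ++ b' :: x₂ ++ b' :: y₂ ++ [d]) ++ v₂ := by
      have : u ++ i :: (x₁ ++ b' :: x₂ ++ b' :: x₃) ++ i :: v =
        (u ++ i :: x₁) ++ b' :: x₂ ++ b' :: (x₃ ++ i :: v) := by simp
      rw [this, hu₁, hv₂]; simp
    rw [hwhole] at hω heq
    obtain rfl := heq c (by simp) hc
    obtain rfl := heq d (by simp) hd
    obtain ⟨j, hj, hj4⟩ := hω.factor.exists_label_four hφ hb hy₁ hx₂ hy₂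
    exact labCount_eq_zero.1 hx j (by simp [hj]) hj4
  | succ k hk ih =>
    have hiC : i ∈ C := hω.mem i (by simp)
    have hxC : ∀ j ∈ x, j ∈ C := fun j hj => hω.mem j (by simp [hj])
    have h1 : cs.IsClusterFactor h (i :: x ++ [i]) :=
      IsClusterFactor.factor (u := u) (v := v) (by simpa using hω.isClusterFactor)
    have nb_le : ∀ z, (∀ j ∈ z, j ∈ x) → nbCount M i z ≤ labCount φ (k + 1) z := by
      intro z hz
      have h3 := nbCount_le_sum_labCount (M := M) (φ := φ) (i := i) [k + 1, k + 1 + 2] z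
        fun j hj hij => label_of_adj_of_four_le hφ hiC (hxC j (hz j hj)) (by omega) hi hij
      have h4 : labCount φ (k + 1 + 2) z = 0 :=
        labCount_eq_zero.2 fun j hj => labCount_eq_zero.1 hx' j (hz j hj)
      simp only [List.map_cons, List.map_nil, List.sum_cons, List.sum_nil, h4] at h3
      omega
    by_cases h4 : labCount φ (k + 1) x ≤ 1
    · have := h1.nbCount_pos
      have := nb_le x fun _ hj => hj
      exact ⟨x, .refl x, by omega⟩
    obtain ⟨y₀, a, y₁, a', y₂, rfl, ha, ha', hy₀, hy₁⟩ :=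
      List.exists_two_of_countP (by omega : 2 ≤ labCount φ (k + 1) x)
    simp only [decide_eq_true_eq] at ha ha'
    obtain rfl := hφ.inj a (hxC a (by simp)) a' (hxC a' (by simp)) (ha.trans ha'.symm)
    change labCount φ (k + 1) y₀ = 0 at hy₀
    change labCount φ (k + 1) y₁ = 0 at hy₁
    have ha2 : φ a ≠ k + 1 + 1 := by omega
    simp only [labCount_append, labCount_cons_of_ne ha2] at hx
    obtain ⟨y₁', ey₁, hy₁'⟩ := ih (u := u ++ i :: y₀) (x := y₁) (v := y₂ ++ i :: v) (i := a)
      (by simpa using hω) ha (by rw [labCount_append]; omega)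
      (by rw [labCount_append, labCount_cons_of_ne (by omega)]; omega) hy₁
      (show labCount φ (k + 1 + 1) y₁ = 0 by omega)
    have hay₁' : a ∉ y₁' := fun hh => labCount_eq_zero.1 hy₁ a ((ey₁.mem_iff a).2 hh) ha
    -- A third occurrence of a would produce two adjacent gaps of a that can both be made short.
    have hy₂ : labCount φ (k + 1) y₂ = 0 := by
      by_contra hne
      obtain ⟨y₃, c, y₄, rfl, hc, hy₃⟩ := List.exists_first_of_countP_pos
        (P := fun j => φ j = k + 1) (x := y₂) (Nat.pos_of_ne_zero hne)
      simp only [decide_eq_true_eq] at hc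
      obtain rfl := hφ.inj c (hxC c (by simp)) a (hxC a (by simp)) (hc.trans ha.symm)
      change labCount φ (k + 1) y₃ = 0 at hy₃
      simp only [labCount_append, labCount_cons_of_ne ha2] at hx
      obtain ⟨y₃', ey₃, hy₃'⟩ := ih (u := u ++ i :: y₀ ++ c :: y₁) (x := y₃)
        (v := y₄ ++ i :: v) (i := c) (by simpa using hω) ha
        (by rw [labCount_append, labCount_append]; omega)
        (by rw [labCount_append, labCount_cons_of_ne (by omega)]; omega) hy₃
        (show labCount φ (k + 1 + 1) y₃ = 0 by omega)
      have e1 := (ey₁.append [c] (c :: y₃ ++ [c])).trans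
        (by simpa using ey₃.append (c :: y₁' ++ [c]) [c])
      have h5 : cs.IsClusterFactor h ([c] ++ y₁ ++ (c :: y₃ ++ [c])) :=
        IsClusterFactor.factor (u := u ++ i :: y₀) (v := y₄ ++ i :: v)
          (by simpa using hω.isClusterFactor)
      have h6 := h5.of_equiv e1
      exact IsClusterFactor.not_two_short_gaps (by simpa using h6) hay₁'
        (fun hh => labCount_eq_zero.1 hy₃ c ((ey₃.mem_iff c).2 hh) ha) hy₁' hy₃'
    obtain ⟨z₁, q, z₂, rfl, haq, hz₁, hz₂⟩ := exists_eq_of_nbCount_eq_one hy₁'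
    -- Braiding the short gap `aqa` into `qaq` leaves a single a, hence a single neighbour of i.
    have e2 : cs.WordEquiv (y₀ ++ a :: y₁ ++ a :: y₂) (y₀ ++ (z₁ ++ [q, a, q] ++ z₂) ++ y₂) := by
      have e3 := ey₁.append (y₀ ++ [a]) (a :: y₂)
      have e4 := (cs.wordEquiv_short_gap_braid h haq hz₁ hz₂).append y₀ y₂
      exact (by simpa using e3 : cs.WordEquiv (y₀ ++ a :: y₁ ++ a :: y₂)
        (y₀ ++ (a :: (z₁ ++ q :: z₂) ++ [a]) ++ y₂)).trans e4
    refine ⟨_, e2, le_antisymm ((nb_le _ fun j hj => (e2.mem_iff j).2 hj).trans ?_) ?_⟩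
    · have hz : ∀ j ∈ z₁ ++ q :: z₂, φ j ≠ k + 1 := fun j hj =>
        labCount_eq_zero.1 hy₁ j ((ey₁.mem_iff j).2 hj)
      have hz' := labCount_eq_zero.2 hz
      have hq : φ q ≠ k + 1 := hz q (by simp)
      simp only [labCount_append, labCount_cons_of_eq ha, labCount_cons_of_ne hq,
        labCount_nil] at hz' ⊢
      omega
    · exact IsClusterFactor.nbCount_pos (h1.of_equiv (by simpa using e2.append [i] [i]))

theorem labCount_le_add (hφ : IsLabelling M C φ) {ω : List B}
    (hω : cs.IsNormalFactor h C φ ω) (k : ℕ) :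
    labCount φ (k + 3) ω ≤ labCount φ 3 ω + k := by
  induction k with
  | zero => simp
  | succ k ih =>
    have := hω.labCount_le_parent hφ (k := k + 1 + 3) (by omega)
    have h1 : parentE (k + 1 + 3) = k + 3 := by
      unfold parentE
      split_ifs <;> omega
    rw [h1] at this
    omega

/-- The last vertex of the long arm occurs at most twice between two occurrences of the branch
vertex. -/
theorem labCount_le_two (hφ : IsLabelling M C φ) {k : ℕ} (hk : 3 ≤ k) {u x v : List B}
    (hω : cs.IsNormalFactor h C φ (u ++ x ++ v)) (hu : 0 < labCount φ 3 u)
    (hv : 0 < labCount φ 3 v) (hx : ∀ j ∈ x, φ j ≤ k + 1) : labCount φ (k + 1) x ≤ 2 := by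
  by_contra hcon
  obtain ⟨x₁, a, x₂, b, x₃, rfl, ha, hb, hx₁, hx₂⟩ :=
    List.exists_two_of_countP (by omega : 2 ≤ labCount φ (k + 1) x)
  simp only [decide_eq_true_eq] at ha hb
  obtain rfl := hφ.inj a (hω.mem a (by simp)) b (hω.mem b (by simp)) (ha.trans hb.symm)
  change labCount φ (k + 1) x₁ = 0 at hx₁
  change labCount φ (k + 1) x₂ = 0 at hx₂
  simp only [labCount_append, labCount_cons_of_eq ha, hx₁, hx₂] at hcon
  obtain ⟨x₄, c, x₅, rfl, hc, hx₄⟩ := List.exists_first_of_countP_pos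
    (P := fun j => φ j = k + 1) (x := x₃) (by change 0 < labCount φ (k + 1) x₃; omega)
  simp only [decide_eq_true_eq] at hc
  obtain rfl := hφ.inj c (hω.mem c (by simp)) a (hω.mem a (by simp)) (hc.trans ha.symm)
  have hlab : ∀ z, (∀ j ∈ z, φ j ≤ k + 1) → labCount φ (k + 2) z = 0 := fun z hz =>
    labCount_eq_zero.2 fun j hj => by have := hz j hj; omega
  have hc3 : φ c ≠ 3 := by omega
  obtain ⟨x₂', e₂, hx₂'⟩ := exists_short_gap hφ hk (u := u ++ x₁) (x := x₂)
    (v := x₄ ++ c :: x₅ ++ v) (by simpa using hω) ha (by rw [labCount_append]; omega)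
    (by rw [labCount_append]; omega) hx₂ (hlab _ fun j hj => hx j (by simp [hj]))
  obtain ⟨x₄', e₄, hx₄'⟩ := exists_short_gap hφ hk (u := u ++ x₁ ++ c :: x₂) (x := x₄)
    (v := x₅ ++ v) (by simpa using hω) ha (by rw [labCount_append, labCount_append]; omega)
    (by rw [labCount_append]; omega) hx₄ (hlab _ fun j hj => hx j (by simp [hj]))
  have e1 := (e₂.append [c] (c :: x₄ ++ [c])).trans
    (by simpa using e₄.append (c :: x₂' ++ [c]) [c])
  have h5 : cs.IsClusterFactor h ([c] ++ x₂ ++ (c :: x₄ ++ [c])) :=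
    IsClusterFactor.factor (u := u ++ x₁) (v := x₅ ++ v) (by simpa using hω.isClusterFactor)
  exact IsClusterFactor.not_two_short_gaps (by simpa using h5.of_equiv e1)
    (fun hh => labCount_eq_zero.1 hx₂ c ((e₂.mem_iff c).2 hh) ha)
    (fun hh => labCount_eq_zero.1 hx₄ c ((e₄.mem_iff c).2 hh) ha) hx₂' hx₄'

/-- Before the first and after the last branch vertex `labCount_le_add` allows k - 2 occurrences
each, and in between `labCount_le_two` allows two. -/
theorem labCount_last_le (hφ : IsLabelling M C φ) {k : ℕ} (hk : 3 ≤ k) {ω : List B}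
    (hω : cs.IsNormalFactor h C φ ω) (hle : ∀ j ∈ ω, φ j ≤ k + 1) :
    labCount φ (k + 1) ω ≤ 2 * k := by
  obtain ⟨m, rfl⟩ := Nat.exists_eq_add_of_le' hk
  have hfree : ∀ {z}, cs.IsNormalFactor h C φ z → labCount φ 3 z = 0 →
      labCount φ (m + 3 + 1) z ≤ m + 1 := fun hz hz3 => by
    have := hz.labCount_le_add hφ (m + 1)
    rw [show m + 3 + 1 = m + 1 + 3 by omega]
    omega
  by_cases h0 : labCount φ 3 ω = 0
  · have := hfree hω h0
    omega
  obtain ⟨u, b, ω', rfl, hb, hu⟩ := List.exists_first_of_countP_pos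
    (P := fun j => φ j = 3) (x := ω) (Nat.pos_of_ne_zero h0)
  simp only [decide_eq_true_eq] at hb
  have hb' : φ b ≠ m + 3 + 1 := by omega
  have h1 := hfree (factor (u := []) (v := b :: ω') (by simpa using hω)) hu
  rw [labCount_append, labCount_cons_of_ne hb']
  by_cases h2 : labCount φ 3 ω' = 0
  · have := hfree (factor (u := u ++ [b]) (v := []) (by simpa using hω)) h2
    omega
  obtain ⟨x, c, v, rfl, hc, hv⟩ := List.exists_last_of_countP_pos
    (P := fun j => φ j = 3) (x := ω') (Nat.pos_of_ne_zero h2)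
  simp only [decide_eq_true_eq] at hc
  have h3 := hfree (factor (u := u ++ b :: x ++ [c]) (v := []) (by simpa using hω)) hv
  have h4 := labCount_le_two hφ (k := m + 3) (by omega) (u := u ++ [b]) (x := x) (v := c :: v)
    (by simpa using hω) (by rw [labCount_append, labCount_cons_of_eq hb]; omega)
    (by rw [labCount_cons_of_eq hc]; omega) fun j hj => hle j (by simp [hj])
  rw [labCount_append, labCount_cons_of_ne (by omega)]
  omega

/-- Normal factors whose letters have bounded labels have bounded length. -/
theorem exists_length_le (hφ : IsLabelling M C φ) (k : ℕ) (hk : 3 ≤ k) :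
    ∃ K, ∀ ω, cs.IsNormalFactor h C φ ω → (∀ j ∈ ω, φ j ≤ k) → ω.length ≤ K := by
  induction k, hk using Nat.le_induction with
  | base =>
    -- A fourth occurrence of the label 3 would force the label 4. Hence 3 occurs at most three
    -- times, 0 and 2 at most four times each and 1 at most five times: 16 in all.
    refine ⟨16, fun ω hω hle => ?_⟩
    have h3 : labCount φ 3 ω ≤ 3 := by
      by_contra hcon
      obtain ⟨x₁, a, x₂, b, x₃, rfl, ha, hb, hx₁, hx₂⟩ :=
        List.exists_two_of_countP (by omega : 2 ≤ labCount φ 3 ω)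
      simp only [decide_eq_true_eq] at ha hb
      change labCount φ 3 x₁ = 0 at hx₁
      change labCount φ 3 x₂ = 0 at hx₂
      simp only [labCount_append, labCount_cons_of_eq ha, labCount_cons_of_eq hb, hx₁, hx₂] at hcon
      obtain ⟨x₄, c, x₅, d, x₆, rfl, hc, hd, hx₄, hx₅⟩ :=
        List.exists_two_of_countP (by omega : 2 ≤ labCount φ 3 x₃)
      simp only [decide_eq_true_eq] at hc hd
      have heq : ∀ {y z}, y ∈ C → z ∈ C → φ y = 3 → φ z = 3 → y = z := fun hy hz h1 h2 =>
        hφ.inj _ hy _ hz (h1.trans h2.symm)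
      obtain rfl := heq (hω.mem a (by simp)) (hω.mem b (by simp)) ha hb
      obtain rfl := heq (hω.mem c (by simp)) (hω.mem a (by simp)) hc ha
      obtain rfl := heq (hω.mem d (by simp)) (hω.mem c (by simp)) hd hc
      obtain ⟨j, hj, hj4⟩ := exists_label_four hφ (b := d) (y₁ := x₂) (x := x₄) (y₂ := x₅)
        (factor (u := x₁) (v := x₆) (by simpa using hω)) hd hx₂ hx₄ hx₅
      have := hle j (by simp [hj])
      omega
    have h0 := hω.labCount_le_parent hφ (k := 0) (by omega)
    have h1 := hω.labCount_le_parent hφ (k := 1) (by omega)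
    have h2 := hω.labCount_le_parent hφ (k := 2) (by omega)
    simp only [parentE] at h0 h1 h2
    norm_num at h0 h1 h2
    have h5 := countP_le_sum_labCount (φ := φ) (P := fun _ => true) [0, 1, 2, 3] ω fun j hj _ => by
      have := hle j hj
      simp only [List.mem_cons, List.not_mem_nil, or_false]
      omega
    simp at h5
    omega
  | succ k hk ih =>
    obtain ⟨K, hK⟩ := ih
    -- At most n letters of label k + 1 cut ω into at most n + 1 blocks, each of length at most K.
    have key : ∀ n ω, cs.IsNormalFactor h C φ ω → (∀ j ∈ ω, φ j ≤ k + 1) →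
        labCount φ (k + 1) ω ≤ n → ω.length ≤ (n + 1) * (K + 1) := by
      have hshort : ∀ ω, cs.IsNormalFactor h C φ ω → (∀ j ∈ ω, φ j ≤ k + 1) →
          labCount φ (k + 1) ω = 0 → ω.length ≤ K := fun ω hω hle h0 =>
        hK ω hω fun j hj => by
          have := hle j hj
          have := labCount_eq_zero.1 h0 j hj
          omega
      intro n
      induction n with
      | zero =>
        intro ω hω hle hn
        have := hshort ω hω hle (by omega)
        omega
      | succ n ihn =>
        intro ω hω hle hn
        by_cases h0 : labCount φ (k + 1) ω = 0
        · have := hshort ω hω hle h0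
          nlinarith
        obtain ⟨y, a, z, rfl, ha, hy⟩ := List.exists_first_of_countP_pos
          (P := fun j => φ j = k + 1) (x := ω) (Nat.pos_of_ne_zero h0)
        simp only [decide_eq_true_eq] at ha
        rw [labCount_append, labCount_cons_of_eq ha] at hn
        have h1 := hshort y (factor (u := []) (v := a :: z) (by simpa using hω))
          (fun j hj => hle j (by simp [hj])) hy
        have h2 := ihn z (factor (u := y ++ [a]) (v := []) (by simpa using hω))
          (fun j hj => hle j (by simp [hj])) (by omega)
        rw [List.length_append, List.length_cons]
        nlinarith
    exact ⟨_, fun ω hω hle => key _ ω hω hle (hω.labCount_last_le hφ hk hle)⟩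

end IsNormalFactor

/-! ### Finiteness of the set of maximally clustered elements -/

/-- Every factor of a reduced expression of a maximally clustered element is equivalent to a
normal one. -/
theorem IsClusterFactor.exists_isNormalFactor {C : Set B} {φ : B → ℕ} {n : ℕ}
    (hn : ∀ i ∈ C, φ i ≤ n) {ω : List B} (hω : cs.IsClusterFactor h ω) (hC : ∀ i ∈ ω, i ∈ C) :
    ∃ ω', cs.WordEquiv ω ω' ∧ cs.IsNormalFactor h C φ ω' := by
  classical
  let wt : List B → ℕ := fun ω => (ω.map fun i => depthE (φ i)).sum
  -- Equivalent words have the same length and letters, so the weight is bounded and attains a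
  -- maximum.
  have hbound : ∀ ω', cs.WordEquiv ω ω' → wt ω' ≤ ω.length * (n + 3) := by
    intro ω' e
    have h1 : ∀ x ∈ ω'.map (fun i => depthE (φ i)), x ≤ n + 3 := by
      intro x hx
      obtain ⟨i, hi, rfl⟩ := List.mem_map.1 hx
      have := hn i (hC i ((e.mem_iff i).2 hi))
      unfold depthE
      split_ifs <;> omega
    have := List.sum_le_card_nsmul _ _ h1
    rwa [List.length_map, ← e.length_eq, smul_eq_mul] at this
  let P : ℕ → Prop := fun s => ∃ ω', cs.WordEquiv ω ω' ∧ wt ω' = s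
  have hP : P (wt ω) := ⟨ω, .refl ω, rfl⟩
  obtain ⟨ω', e, hw⟩ := Nat.findGreatest_spec (P := P) (hbound ω (.refl ω)) hP
  refine ⟨ω', e, hω.of_equiv e, fun i hi => hC i ((e.mem_iff i).2 hi), fun ω'' e' => ?_⟩
  have h1 := e.trans e'
  have h2 := Nat.le_findGreatest (P := P) (hbound ω'' h1) ⟨ω'', h1, rfl⟩
  rw [← hw] at h2
  exact h2

theorem wordEquiv_filter (cs : CoxeterSystem M W) (h : M.IsSimplyLaced) {P : B → Bool}
    (hP : ∀ i j, P i = false → P j = true → M i j ≠ 3) (ω : List B) :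
    cs.WordEquiv ω (ω.filter P ++ ω.filter fun i => !P i) := by
  induction ω with
  | nil => exact .refl _
  | cons j ω ih =>
    have h1 := ih.append [j] []
    by_cases hj : P j
    · simpa [hj] using h1
    · simp only [Bool.not_eq_true] at hj
      have h2 := (cs.wordEquiv_commute h (i := j) (x := ω.filter P)
        (nbCount_eq_zero.2 fun k hk => hP j k hj (List.mem_filter.1 hk).2)).append []
        (ω.filter fun i => !P i)
      have h3 := h1.trans (by simpa using h2)
      simpa [hj] using h3

/-- If the components of the Coxeter graph are subgraphs of graphs of type `E`, then there are
only finitely many maximally clustered elements. -/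
theorem finite_maximallyClustered (cs : CoxeterSystem M W) (h : M.IsSimplyLaced) [Finite B]
    (hE : ∀ C : M.coxeterGraph.ConnectedComponent,
      ∃ n : ℕ, 6 ≤ n ∧ C.toSimpleGraph.IsContained (coxeterGraphE n)) :
    {w : W | cs.IsMaximallyClustered h w}.Finite := by
  classical
  have hcomp : ∀ C : M.coxeterGraph.ConnectedComponent, ∃ K, ∀ ω, cs.IsClusterFactor h ω →
      (∀ i ∈ ω, i ∈ C.supp) → ω.length ≤ K := by
    intro C
    obtain ⟨n, hn, ⟨f⟩⟩ := hE C
    let φ : B → ℕ := fun i => if hi : i ∈ C.supp then f ⟨i, hi⟩ else 0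
    have hφC : ∀ i (hi : i ∈ C.supp), φ i = f ⟨i, hi⟩ := fun i hi => dif_pos hi
    have hφ : IsLabelling M C.supp φ := by
      refine ⟨fun i hi j hj he => ?_, fun i hi j hj hij => ?_⟩
      · rw [hφC i hi, hφC j hj] at he
        exact congrArg Subtype.val (f.injective (Fin.ext he))
      · have hadj : C.toSimpleGraph.Adj ⟨i, hi⟩ ⟨j, hj⟩ := by
          have : M.coxeterGraph.Adj i j := ⟨ne_of_eq_three hij, hij⟩
          exact this
        have hf : (coxeterGraphE n).Adj (f ⟨i, hi⟩) (f ⟨j, hj⟩) := f.toHom.map_adj hadj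
        replace hf := (SimpleGraph.fromRel_adj _ _ _).1 hf
        rw [hφC i hi, hφC j hj]
        generalize ((f ⟨i, hi⟩ : Fin n) : ℕ) = a at hf ⊢
        generalize ((f ⟨j, hj⟩ : Fin n) : ℕ) = b at hf ⊢
        unfold parentE
        obtain ⟨-, hf⟩ := hf
        split_ifs <;> omega
    have hφn : ∀ i ∈ C.supp, φ i ≤ n := fun i hi => by
      rw [hφC i hi]; exact (f ⟨i, hi⟩).2.le
    obtain ⟨K, hK⟩ := IsNormalFactor.exists_length_le (cs := cs) (h := h) hφ n (by omega)
    refine ⟨K, fun ω hω hωC => ?_⟩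
    obtain ⟨ω', e, hω'⟩ := hω.exists_isNormalFactor hφn hωC
    rw [e.length_eq]
    exact hK ω' hω' fun j hj => hφn j (hω'.mem j hj)
  choose K hK using hcomp
  have := Fintype.ofFinite B
  refine ((List.finite_length_le B
    (∑ i : B, K (M.coxeterGraph.connectedComponentMk i))).image cs.wordProd).subset ?_
  intro w hw
  obtain ⟨ω, hω, rfl⟩ := cs.exists_isReduced w
  refine ⟨ω, ?_, rfl⟩
  change ω.length ≤ _
  have hlen : ω.length = ∑ i : B, ω.count i := by
    simpa using (Multiset.sum_count_eq_card (s := Finset.univ) (m := (ω : Multiset B))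
      fun _ _ => Finset.mem_univ _).symm
  rw [hlen]
  -- The letters from the component of i can be commuted to the front, where they form a factor
  -- whose length bounds the number of occurrences of i.
  refine Finset.sum_le_sum fun i _ => ?_
  set C := M.coxeterGraph.connectedComponentMk i with hC
  let P : B → Bool := fun j => decide (j ∈ C.supp)
  have hP : ∀ i j, P i = false → P j = true → M i j ≠ 3 := by
    intro a b ha hb hab
    simp only [P, decide_eq_false_iff_not, decide_eq_true_eq] at ha hb
    have hadj : M.coxeterGraph.Adj a b := ⟨ne_of_eq_three hab, hab⟩
    exact ha ((SimpleGraph.ConnectedComponent.mem_supp_congr_adj C hadj).2 hb)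
  have hcl : cs.IsClusterFactor h ω := ⟨[], [], by simpa using hω, by simpa using hw⟩
  have hcl' : cs.IsClusterFactor h (ω.filter P) :=
    IsClusterFactor.factor (u := []) (v := ω.filter fun i => !P i)
      (by simpa using hcl.of_equiv (wordEquiv_filter cs h hP ω))
  refine le_trans ?_ (hK C _ hcl' fun j hj => by simpa [P] using (List.mem_filter.1 hj).2)
  have hi : P i = true := by
    simp only [P, decide_eq_true_eq]
    exact SimpleGraph.ConnectedComponent.mem_supp_iff C i |>.2 rfl
  rw [← List.count_filter (l := ω) hi]
  exact List.count_le_length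

end CoxeterSystem

theorem theorem5p3 {B W : Type*} [Group W] {M : CoxeterMatrix B} (cs : CoxeterSystem M W)
    (h : M.IsSimplyLaced) :
    List.TFAE
      [{w : W | cs.IsMaximallyClustered h w}.Finite,
       {w : W | cs.IsFreelyBraided h w}.Finite,
       {w : W | cs.IsFullyCommutative w}.Finite] ∧
    (∀ w : W, cs.IsFullyCommutative w ↔ cs.IsIjiAvoiding w) ∧
    ({w : W | cs.IsMaximallyClustered h w}.Finite ↔
      Finite B ∧ ∀ C : M.coxeterGraph.ConnectedComponent,
        ∃ n : ℕ, 6 ≤ n ∧ C.toSimpleGraph.IsContained (coxeterGraphE n)) := by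
  have hfc := cs.isFullyCommutative_iff_isIjiAvoiding h
  have h12 : {w : W | cs.IsMaximallyClustered h w}.Finite →
      {w : W | cs.IsFreelyBraided h w}.Finite := fun hf => hf.subset fun w hw => hw.1
  have h23 : {w : W | cs.IsFreelyBraided h w}.Finite →
      {w : W | cs.IsFullyCommutative w}.Finite := fun hf => hf.subset fun w hw =>
    CoxeterSystem.IsIjiAvoiding.isFreelyBraided cs h ((hfc w).1 hw)
  have h3E : {w : W | cs.IsFullyCommutative w}.Finite →
      Finite B ∧ ∀ C : M.coxeterGraph.ConnectedComponent,
        ∃ n : ℕ, 6 ≤ n ∧ C.toSimpleGraph.IsContained (coxeterGraphE n) := by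
    intro hf
    have hB : Finite B := by
      by_contra hB
      rw [not_finite_iff_infinite] at hB
      exact cs.infinite_fullyCommutative_of_infinite h hf
    refine ⟨hB, fun C => ?_⟩
    refine SimpleGraph.exists_isContained_coxeterGraphE C.connected_toSimpleGraph fun hG => ?_
    refine cs.infinite_fullyCommutative_of_hasInfinitePlay h (hG.of_isContained ?_) hf
    exact ⟨⟨⟨Subtype.val, fun {v w} hvw => hvw⟩, Subtype.val_injective⟩⟩
  have hE1 : (Finite B ∧ ∀ C : M.coxeterGraph.ConnectedComponent,
      ∃ n : ℕ, 6 ≤ n ∧ C.toSimpleGraph.IsContained (coxeterGraphE n)) →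
      {w : W | cs.IsMaximallyClustered h w}.Finite := by
    rintro ⟨hB, hE⟩
    exact cs.finite_maximallyClustered h hE
  refine ⟨?_, hfc, fun hf => h3E (h23 (h12 hf)), hE1⟩
  tfae_have 1 → 2 := h12
  tfae_have 2 → 3 := h23
  tfae_have 3 → 1 := fun hf => hE1 (h3E hf)
  tfae_finish
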